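/- **Conventions.** All distributions are complex-valued. A locally convex space of distributions on $\mathbb R^n$ is a vector subspace $\mathcal H\subseteq\mathcal D'(\mathbb R^n)$ with a locally convex topology; it is a *normal space of distributions* if $\mathcal D\subseteq\mathcal H\subseteq\mathcal D'$ with continuous inclusions ($\mathcal D'$ with its strong topology) and $\mathcal D$ is dense in $\mathcal H$. For a locally convex space $E$, $E'_c$ is the dual of $E$ with the topology of uniform convergence on the absolutely convex compact subsets of $E$, and $\mathcal L_c(E,F)$ is the space of continuous linear maps $E\to F$ with the topology of uniform convergence on the same sets. $E$ *carries the topology $\gamma$* if $(E'_c)'_c=E$ topologically, i.e. if the absolutely convex compact subsets of $E'_c$ are equicontinuous. $E$ has the *convex compactness property* if every compact subset of $E$ is contained in an absolutely convex compact subset (for Hausdorff $E$: closed absolutely convex hulls of compact sets are compact); this holds if $E$ is quasi-complete. For a locally convex space $\mathcal H$ of distributions, $\mathcal H(E)$ is the space of all $E$-valued distributions $S\in\mathcal D'(E)=\mathcal L(\mathcal D,E)$ such that $\langle S,e'\rangle:=e'\circ S\in\mathcal H$ for all $e'\in E'$ and $e'\mapsto\langle S,e'\rangle$ is continuous $E'_c\to\mathcal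 H$; it carries the topology of $\mathcal H\mathbin{\varepsilon}E$, i.e. of uniform convergence of $e'\mapsto \langle S,e'\rangle$ on the equicontinuous subsets of $E'$. For a normal space of distributions $\mathcal K$ and a Hausdorff locally convex space $\mathcal N\subseteq\mathcal D'(E)$ of $E$-valued distributions (scalar distributions being the case $E=\mathbb C$), $$\mathcal O_M(\mathcal K,\mathcal N)=\{S\in\mathcal D'(E):\ \exists\,[S]\in\mathcal L(\mathcal K,\mathcal N)\text{ with }[S](\varphi)=\varphi\cdot S\ \ \forall\varphi\in\mathcal D\},$$ where $(\varphi\cdot S)(\psi)=S(\varphi\psi)$; it carries the topology induced by $S\mapsto[S]$ from $\mathcal L_c(\mathcal K,\mathcal N)$. **Proposition.** Let $\mathcal K,\mathcal L,\mathfrak M$ be normal spaces of distributions on $\mathbb R^n$ and $E$ a normal space of distributions on $\mathbb R^m$. Assume that $\mathcal K$ carries the topology $\gamma$ and that $\mathcal K'_c$ and $E$ have the convex compactness property. If $\mathfrak M=\mathcal O_M(\mathcal K,\mathcal L)$ (as sets and topologically), then $$\mathfrak M(E)=\mathcal O_M(\mathcal K,\mathcal L(E))$$ (as sets and topologically). Moreover,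 for every normal space of distributions $E$ on $\mathbb R^m$, $$\mathcal D'(E)=\mathcal O_M(\mathcal D,\mathcal E'(E)),\qquad \mathcal S'(E)=\mathcal O_M(\mathcal S,\mathcal O_C'(E))$$ as sets and topologically, where $\mathcal D',\mathcal E',\mathcal S',\mathcal O'_C$ are the strong duals of $\mathcal D$, $\mathcal E=C^\infty$, $\mathcal S$ and $\mathcal O_C$ on $\mathbb R^n$, and $\mathcal O_C$ (the smooth functions all of whose derivatives are $O((1+|x|)^k)$ for one common $k$) carries its inductive limit topology over $k$. -/

import Mathlib

open scoped Topology Distributions SchwartzMap ContDiff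

noncomputable section

namespace VVDist

/-! ## Distributions and vector-valued distributions on `ℝⁿ` -/

/-- `ℝⁿ` with its Euclidean norm. -/
abbrev Rn (n : ℕ) : Type := EuclideanSpace ℝ (Fin n)

/-- The space `𝒟(ℝⁿ)` of complex-valued test functions with its usual (LF) topology. -/
abbrev Test (n : ℕ) : Type := 𝓓((⊤ : TopologicalSpace.Opens (Rn n)), ℂ)

/-- The space `𝒟'(ℝⁿ; V) = L(𝒟(ℝⁿ), V)` of `V`-valued distributions. It carries the topology of
uniform convergence on the bounded subsets of `𝒟(ℝⁿ)`; for `V = ℂ` it is the strong dual of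
`𝒟(ℝⁿ)`. -/
abbrev Dist (n : ℕ) (V : Type*) [AddCommGroup V] [Module ℂ V] [TopologicalSpace V] : Type _ :=
  Test n →L[ℂ] V

/-- The product of two test functions. -/
def testMul {n : ℕ} (φ ψ : Test n) : Test n where
  toFun x := φ x * ψ x
  contDiff' := φ.contDiff.mul ψ.contDiff
  hasCompactSupport' := φ.hasCompactSupport.mul_right
  tsupport_subset' := fun _ _ => trivial

/-- The distribution `ψ ↦ ∫ ψ f` given by a locally integrable function `f`. -/
def regularDist {n : ℕ} (f : Rn n → ℂ) : Dist n ℂ :=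
  TestFunction.integralAgainstBilinCLM (ContinuousLinearMap.mul ℂ ℂ) MeasureTheory.volume f

lemma regularDist_apply {n : ℕ} {f : Rn n → ℂ} (hf : Continuous f) (ψ : Test n) :
    regularDist f ψ = ∫ x, ψ x * f x := by
  have h : MeasureTheory.LocallyIntegrableOn f ((⊤ : TopologicalSpace.Opens (Rn n)) : Set (Rn n))
      MeasureTheory.volume := hf.locallyIntegrable.locallyIntegrableOn _
  simp [regularDist, TestFunction.integralAgainstBilinCLM_eq_integral h]

lemma integrable_test_mul {n : ℕ} {f : Rn n → ℂ} (hf : Continuous f) (ψ : Test n) :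
    MeasureTheory.Integrable (fun x => ψ x * f x) :=
  (ψ.continuous.mul hf).integrable_of_hasCompactSupport ψ.hasCompactSupport.mul_right

lemma regularDist_add {n : ℕ} {f g : Rn n → ℂ} (hf : Continuous f) (hg : Continuous g) :
    regularDist (fun x => f x + g x) = regularDist f + regularDist g := by
  ext ψ
  rw [add_apply, regularDist_apply (f := fun x => f x + g x) (hf.add hg), regularDist_apply hf,
    regularDist_apply hg]
  simp only [mul_add]
  exact MeasureTheory.integral_add (integrable_test_mul hf ψ) (integrable_test_mul hg ψ)

lemma regularDist_smul {n : ℕ} {f : Rn n → ℂ} (c : ℂ) (hf : Continuous f) :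
    regularDist (fun x => c * f x) = c • regularDist f := by
  ext ψ
  rw [smul_apply, regularDist_apply (f := fun x => c * f x) (continuous_const.mul hf),
    regularDist_apply hf, smul_eq_mul, ← MeasureTheory.integral_const_mul]
  congr 1
  funext x
  ring

instance (n : ℕ) : ContinuousSMul ℂ (Test n) := by
  let J : Test n →L[ℂ] Test n :=
    TestFunction.postcompCLM (Complex.I • ContinuousLinearMap.id ℂ ℂ)
  constructor
  have h : (fun p : ℂ × Test n => p.1 • p.2) = fun p => p.1.re • p.2 + p.1.im • J p.2 := by
    funext p
    ext x
    have : J p.2 x = Complex.I * p.2 x := rfl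
    change p.1 * p.2 x = (p.1.re : ℝ) • p.2 x + (p.1.im : ℝ) • J p.2 x
    rw [this, Complex.real_smul, Complex.real_smul]
    conv_lhs => rw [← Complex.re_add_im p.1]
    ring
  rw [h]
  have hJ : Continuous fun p : ℂ × Test n => J p.2 := J.continuous.comp continuous_snd
  exact ((Complex.continuous_re.comp continuous_fst).smul continuous_snd).add
    ((Complex.continuous_im.comp continuous_fst).smul hJ)

/-- The inclusion `𝒟(ℝⁿ) → 𝒟'(ℝⁿ)`. -/
def testToDist (n : ℕ) : Test n →ₗ[ℂ] Dist n ℂ where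
  toFun φ := regularDist φ
  map_add' φ ψ := regularDist_add φ.continuous ψ.continuous
  map_smul' c φ := regularDist_smul c φ.continuous

/-! ## Locally convex spaces of (vector-valued) distributions -/

/-- A vector subspace of `𝒟'(ℝⁿ; V)` together with a topology on it (in general not the one
induced by `𝒟'(ℝⁿ; V)`). -/
@[ext]
structure TopSubspace (n : ℕ) (V : Type*) [AddCommGroup V] [Module ℂ V] [TopologicalSpace V]
    [IsTopologicalAddGroup V] [ContinuousSMul ℂ V] where
  carrier : Submodule ℂ (Dist n V)
  topology : TopologicalSpace carrier

section Generic

variable {n : ℕ} {V : Type*} [AddCommGroup V] [Module ℂ V] [TopologicalSpace V]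
  [IsTopologicalAddGroup V] [ContinuousSMul ℂ V]

/-- The elements of a `TopSubspace`, as a type carrying the topology of the `TopSubspace`. -/
def TopSubspace.Elem (X : TopSubspace n V) : Type _ := X.carrier

instance (X : TopSubspace n V) : AddCommGroup X.Elem := inferInstanceAs (AddCommGroup X.carrier)

instance (X : TopSubspace n V) : Module ℂ X.Elem := inferInstanceAs (Module ℂ X.carrier)

instance (X : TopSubspace n V) : TopologicalSpace X.Elem := X.topology

/-- An element `S` of the underlying subspace, as an element of `X.Elem`. -/
def TopSubspace.elem (X : TopSubspace n V) (S : Dist n V) (hS : S ∈ X.carrier) : X.Elem := ⟨S, hS⟩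

/-- The inclusion of the subspace into `𝒟'(ℝⁿ; V)`. -/
def TopSubspace.incl (X : TopSubspace n V) : X.Elem →ₗ[ℂ] Dist n V := X.carrier.subtype

end Generic

/-- A vector subspace of `𝒟'(ℝⁿ; V)` with a locally convex vector space topology. -/
structure LCSubspace (n : ℕ) (V : Type*) [AddCommGroup V] [Module ℂ V] [TopologicalSpace V]
    [IsTopologicalAddGroup V] [ContinuousSMul ℂ V] extends TopSubspace n V where
  isTopologicalAddGroup : IsTopologicalAddGroup toTopSubspace.Elem
  continuousSMul : ContinuousSMul ℂ toTopSubspace.Elem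
  locallyConvexSpace : LocallyConvexSpace ℝ toTopSubspace.Elem

section Generic

variable {n : ℕ} {V : Type*} [AddCommGroup V] [Module ℂ V] [TopologicalSpace V]
  [IsTopologicalAddGroup V] [ContinuousSMul ℂ V]

/-- The elements of an `LCSubspace`, as a locally convex space. -/
abbrev LCSubspace.Elem (X : LCSubspace n V) : Type _ := X.toTopSubspace.Elem

instance (X : LCSubspace n V) : IsTopologicalAddGroup X.Elem := X.isTopologicalAddGroup

instance (X : LCSubspace n V) : ContinuousSMul ℂ X.Elem := X.continuousSMul

instance (X : LCSubspace n V) : LocallyConvexSpace ℝ X.Elem := X.locallyConvexSpace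

end Generic

/-- `𝓗` is a normal space of distributions: `𝒟 ⊆ 𝓗 ⊆ 𝒟'` with continuous inclusions, and `𝒟` is
dense in `𝓗`. -/
structure LCSubspace.IsNormal {n : ℕ} (H : LCSubspace n ℂ) : Prop where
  continuous_incl : Continuous H.incl
  testToDist_mem : ∀ φ : Test n, testToDist n φ ∈ H.carrier
  continuous_test : Continuous fun φ : Test n => H.elem (testToDist n φ) (testToDist_mem φ)
  dense_test : DenseRange fun φ : Test n => H.elem (testToDist n φ) (testToDist_mem φ)

/-! ## The dual `E'_c`, the topology `γ`, and the `ε`-product -/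

section Dual

variable (E : Type*) [AddCommGroup E] [Module ℂ E] [TopologicalSpace E]

/-- The absolutely convex compact subsets of `E`. -/
def absConvexCompacts : Set (Set E) := {C | Balanced ℂ C ∧ Convex ℝ C ∧ IsCompact C}

/-- `E'_c`: the dual of `E` with the topology of uniform convergence on the absolutely convex
compact subsets of `E`. -/
abbrev DualC : Type _ :=
  UniformConvergenceCLM (RingHom.id ℂ) ℂ (absConvexCompacts E)

/-- The equicontinuous subsets of the dual of `E`. -/
def equicontinuousSets : Set (Set (DualC E)) :=
  {A | ∃ U ∈ 𝓝 (0 : E), ∀ f ∈ A, ∀ x ∈ U, ‖f x‖ ≤ 1}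

/-- `E` carries the topology `γ`, the topology of uniform convergence on the absolutely convex
compact subsets of `E'_c`; equivalently `(E'_c)'_c = E`. (The topology of a Hausdorff locally convex
space `E` is always coarser than this one, and it is equal to it if and only if every absolutely
convex compact subset of `E'_c` is equicontinuous.) -/
def HasTopologyGamma : Prop := absConvexCompacts (DualC E) ⊆ equicontinuousSets E

/-- The convex compactness property: every compact set is contained in an absolutely convex compact
set. In a Hausdorff locally convex space this says that the closed absolutely convex hull of every
compact set is compact, which is the case in every quasi-complete space. -/
def ConvexCompactness : Prop :=
  ∀ P : Set E, IsCompact P → ∃ C ∈ absConvexCompacts E, P ⊆ C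

/-- `H ε E = L_ε(E'_c, H)`: the continuous linear maps from `E'_c` to `H`, with the topology of
uniform convergence on the equicontinuous subsets of the dual of `E`. -/
abbrev EpsProd (H : Type*) [AddCommGroup H] [Module ℂ H] [TopologicalSpace H] : Type _ :=
  UniformConvergenceCLM (RingHom.id ℂ) (E := DualC E) H (equicontinuousSets E)

/-- `L_c(E, H)`: the continuous linear maps from `E` to `H`, with the topology of uniform convergence
on the absolutely convex compact subsets of `E`. -/
abbrev LinC (H : Type*) [AddCommGroup H] [Module ℂ H] [TopologicalSpace H] : Type _ :=
  UniformConvergenceCLM (RingHom.id ℂ) (E := E) H (absConvexCompacts E)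

end Dual

section EpsLemmas

variable {E : Type*} [AddCommGroup E] [Module ℂ E] [TopologicalSpace E]

lemma equicontinuousSets_nonempty : (equicontinuousSets E).Nonempty :=
  ⟨∅, Set.univ, Filter.univ_mem, fun _ h => h.elim⟩

lemma equicontinuousSets_directed : DirectedOn (· ⊆ ·) (equicontinuousSets E) := by
  rintro A ⟨U, hU, hA⟩ B ⟨U', hU', hB⟩
  refine ⟨A ∪ B, ⟨U ∩ U', Filter.inter_mem hU hU', ?_⟩, Set.subset_union_left,
    Set.subset_union_right⟩
  rintro f (hf | hf) x hx
  · exact hA f hf x hx.1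
  · exact hB f hf x hx.2

lemma equicontinuousSets_bounded [IsTopologicalAddGroup E] [ContinuousSMul ℂ E]
    (A : Set (DualC E)) (hA : A ∈ equicontinuousSets E) : Bornology.IsVonNBounded ℂ A := by
  obtain ⟨U, hU, hA⟩ := hA
  rw [UniformConvergenceCLM.isVonNBounded_iff]
  rintro C ⟨-, -, hC⟩
  let _ : UniformSpace E := IsTopologicalAddGroup.rightUniformSpace E
  have : IsUniformAddGroup E := isUniformAddGroup_of_addCommGroup
  have hb : Bornology.IsVonNBounded ℂ C := hC.totallyBounded.isVonNBounded ℂ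
  obtain ⟨r, hr, hrC⟩ := (hb hU).exists_pos
  rw [NormedSpace.isVonNBounded_iff ℂ, isBounded_iff_forall_norm_le]
  refine ⟨r, ?_⟩
  rintro _ ⟨f, hf, x, hx, rfl⟩
  obtain ⟨y, hy, rfl⟩ := hrC (r : ℂ) (by simp [abs_of_pos hr]) hx
  have := hA f hf y hy
  simp only [map_smul, norm_smul, Complex.norm_real, Real.norm_eq_abs, abs_of_pos hr]
  nlinarith

end EpsLemmas

/-! ## Vector-valued spaces of distributions `𝓗(V) = 𝓗 ε V` -/

section Vec

variable {n : ℕ} (H : LCSubspace n ℂ) (V : Type*) [AddCommGroup V] [Module ℂ V]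
  [TopologicalSpace V] [IsTopologicalAddGroup V] [ContinuousSMul ℂ V]

/-- The `V`-valued distributions `S` such that `⟨S, e'⟩ = e' ∘ S` belongs to `𝓗` for all `e' ∈ V'`
and such that `e' ↦ ⟨S, e'⟩` is a continuous map `V'_c → 𝓗`. -/
def vecCarrier : Submodule ℂ (Dist n V) where
  carrier := {S | ∃ u : EpsProd V H.Elem, ∀ (e : DualC V) (φ : Test n), H.incl (u e) φ = e (S φ)}
  add_mem' := by
    rintro S T ⟨u, hu⟩ ⟨v, hv⟩
    refine ⟨u + v, fun e φ => ?_⟩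
    have : (u + v) e = u e + v e := rfl
    rw [this, map_add, add_apply, hu, hv, add_apply,
      map_add]
  zero_mem' := ⟨0, fun e φ => by
    have : (0 : EpsProd V H.Elem) e = 0 := rfl
    simp [this]⟩
  smul_mem' := by
    rintro c S ⟨u, hu⟩
    refine ⟨c • u, fun e φ => ?_⟩
    have : (c • u) e = c • u e := rfl
    rw [this, map_smul, smul_apply, hu, smul_apply,
      map_smul]

lemma vecCarrier_exists (S : vecCarrier H V) :
    ∃ u : EpsProd V H.Elem, ∀ (e : DualC V) (φ : Test n), H.incl (u e) φ = e (S.1 φ) := S.2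

lemma eps_unique {S : Dist n V} {u v : EpsProd V H.Elem}
    (hu : ∀ (e : DualC V) (φ : Test n), H.incl (u e) φ = e (S φ))
    (hv : ∀ (e : DualC V) (φ : Test n), H.incl (v e) φ = e (S φ)) : u = v := by
  ext e
  apply (Submodule.subtype_injective H.carrier : Function.Injective H.incl)
  ext φ
  exact (hu e φ).trans (hv e φ).symm

/-- The element of `𝓗 ε V = L_ε(V'_c, 𝓗)` that is given by an element of `𝓗(V)`. -/
def vecToEps : vecCarrier H V →ₗ[ℂ] EpsProd V H.Elem where
  toFun S := Classical.choose (vecCarrier_exists H V S)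
  map_add' S T := by
    refine eps_unique H V (Classical.choose_spec (vecCarrier_exists H V (S + T))) fun e φ => ?_
    rw [add_apply, map_add, add_apply, Classical.choose_spec (vecCarrier_exists H V S),
      Classical.choose_spec (vecCarrier_exists H V T)]
    exact (map_add e _ _).symm
  map_smul' c S := by
    refine eps_unique H V (Classical.choose_spec (vecCarrier_exists H V (c • S))) fun e φ => ?_
    rw [RingHom.id_apply, smul_apply, map_smul, smul_apply,
      Classical.choose_spec (vecCarrier_exists H V S)]
    exact (map_smul e _ _).symm

lemma vecToEps_apply (S : vecCarrier H V) (e : DualC V) (φ : Test n) :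
    H.incl (vecToEps H V S e) φ = e (S.1 φ) :=
  Classical.choose_spec (vecCarrier_exists H V S) e φ

instance : ContinuousSMul ℂ (EpsProd V H.Elem) :=
  UniformConvergenceCLM.continuousSMul _ _ _ equicontinuousSets_bounded

lemma continuousSMul_real (X : Type*) [AddCommGroup X] [Module ℂ X] [TopologicalSpace X]
    [ContinuousSMul ℂ X] : ContinuousSMul ℝ X := IsScalarTower.continuousSMul ℂ

instance : LocallyConvexSpace ℝ (EpsProd V H.Elem) :=
  have := continuousSMul_real H.Elem
  UniformConvergenceCLM.locallyConvexSpace ℝ _ equicontinuousSets_nonempty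
    equicontinuousSets_directed

/-- The space `𝓗(V)` of `V`-valued distributions, with the topology of `𝓗 ε V = L_ε(V'_c, 𝓗)`. -/
def LCSubspace.vec : LCSubspace n V where
  carrier := vecCarrier H V
  topology := TopologicalSpace.induced (vecToEps H V) inferInstance
  isTopologicalAddGroup := topologicalAddGroup_induced (vecToEps H V)
  continuousSMul := continuousSMul_induced (vecToEps H V)
  locallyConvexSpace := LocallyConvexSpace.induced ((vecToEps H V).restrictScalars ℝ)

end Vec

/-! ## The multiplier spaces `𝓞_M(𝓚, 𝓛)` -/

section Multipliers

variable {n : ℕ} {V : Type*} [AddCommGroup V] [Module ℂ V] [TopologicalSpace V]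
  [IsTopologicalAddGroup V] [ContinuousSMul ℂ V]

/-- `T : 𝓚 → 𝓛` extends the map `φ ↦ φ · S` on test functions; here `(φ · S)(ψ) = S(φ ψ)`. -/
def ExtendsMul (K : LCSubspace n ℂ) (L : LCSubspace n V) (S : Dist n V)
    (T : LinC K.Elem L.Elem) : Prop :=
  ∀ (φ : Test n) (h : testToDist n φ ∈ K.carrier) (ψ : Test n),
    L.incl (T (K.elem (testToDist n φ) h)) ψ = S (testMul φ ψ)

/-- The set `𝓞_M(𝓚, 𝓛)` of all `S ∈ 𝒟'(ℝⁿ; V)` for which there is a continuous linear map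
`[S] : 𝓚 → 𝓛` with `[S](φ) = φ · S` for all test functions `φ`. -/
def OMCarrier (K : LCSubspace n ℂ) (L : LCSubspace n V) : Submodule ℂ (Dist n V) where
  carrier := {S | ∃ T : LinC K.Elem L.Elem, ExtendsMul K L S T}
  add_mem' := by
    rintro S S' ⟨T, hT⟩ ⟨T', hT'⟩
    refine ⟨T + T', fun φ h ψ => ?_⟩
    rw [add_apply, map_add, add_apply, hT, hT', add_apply]
  zero_mem' := ⟨0, fun φ h ψ => by simp⟩
  smul_mem' := by
    rintro c S ⟨T, hT⟩
    refine ⟨c • T, fun φ h ψ => ?_⟩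
    rw [smul_apply, map_smul, smul_apply, hT, smul_apply]

/-- The map `S ↦ [S]` from `𝓞_M(𝓚, 𝓛)` to `L_c(𝓚, 𝓛)`. (If `𝒟` is dense in `𝓚` and `𝓛` is
Hausdorff, then `[S]` is uniquely determined by `S`.) -/
def mulOperator (K : LCSubspace n ℂ) (L : LCSubspace n V) (S : OMCarrier K L) :
    LinC K.Elem L.Elem :=
  Classical.choose (p := ExtendsMul K L S.1) S.2

/-- The multiplier space `𝓞_M(𝓚, 𝓛)`, with the topology induced by `S ↦ [S]` from `L_c(𝓚, 𝓛)`. -/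
def OM (K : LCSubspace n ℂ) (L : LCSubspace n V) : TopSubspace n V where
  carrier := OMCarrier K L
  topology := TopologicalSpace.induced (mulOperator K L) inferInstance

end Multipliers

/-! ## The spaces `𝒟`, `𝒟'`, `𝓔'`, `𝒮`, `𝒮'`, `𝓞'_C` -/

section Range

variable {X : Type*} [AddCommGroup X] [Module ℂ X] [TopologicalSpace X]

lemma isOpenQuotientMap_rangeRestrict [IsTopologicalAddGroup X] {W : Type*} [AddCommGroup W]
    [Module ℂ W] (ι : X →ₗ[ℂ] W) :
    @IsOpenQuotientMap X (LinearMap.range ι) _ (TopologicalSpace.coinduced ι.rangeRestrict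
      inferInstance) ι.rangeRestrict := by
  let _ : TopologicalSpace (LinearMap.range ι) := .coinduced ι.rangeRestrict inferInstance
  refine ⟨ι.surjective_rangeRestrict, continuous_coinduced_rng, fun U hU => ?_⟩
  rw [isOpen_coinduced]
  have : ι.rangeRestrict ⁻¹' (ι.rangeRestrict '' U) =
      ⋃ k ∈ {k : X | ι.rangeRestrict k = 0}, (fun x => x + k) ⁻¹' U := by
    ext x
    simp only [Set.mem_preimage, Set.mem_image, Set.mem_iUnion, Set.mem_ofPred_eq, exists_prop]
    constructor
    · rintro ⟨y, hy, h⟩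
      exact ⟨y - x, by rw [map_sub, h, sub_self], by simpa using hy⟩
    · rintro ⟨k, hk, h⟩
      exact ⟨x + k, h, by rw [map_add, hk, add_zero]⟩
  rw [this]
  exact isOpen_biUnion fun k _ => hU.preimage (continuous_add_const k)

/-- The range of an injective linear map `ι` from a locally convex space `X` into `𝒟'(ℝⁿ)`, with the
topology transported from `X`. (It is written as the finest topology for which `X → range ι` is
continuous; all the maps `ι` used below are injective.) -/
def LCSubspace.ofRange {n : ℕ} [IsTopologicalAddGroup X] [ContinuousSMul ℂ X]
    [LocallyConvexSpace ℝ X] (ι : X →ₗ[ℂ] Dist n ℂ) : LCSubspace n ℂ where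
  carrier := LinearMap.range ι
  topology := TopologicalSpace.coinduced ι.rangeRestrict inferInstance
  isTopologicalAddGroup := by
    let _ : TopologicalSpace (LinearMap.range ι) := .coinduced ι.rangeRestrict inferInstance
    have hq := isOpenQuotientMap_rangeRestrict ι
    refine @IsTopologicalAddGroup.mk (LinearMap.range ι) _ _ ⟨?_⟩ ⟨?_⟩
    · rw [(hq.prodMap hq).isQuotientMap.continuous_iff]
      exact hq.continuous.comp (continuous_add (M := X)) |>.congr fun p => map_add _ _ _
    · rw [hq.isQuotientMap.continuous_iff]
      exact hq.continuous.comp (continuous_neg (G := X)) |>.congr fun p => map_neg _ _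
  continuousSMul := by
    let _ : TopologicalSpace (LinearMap.range ι) := .coinduced ι.rangeRestrict inferInstance
    have hq := isOpenQuotientMap_rangeRestrict ι
    refine @ContinuousSMul.mk ℂ (LinearMap.range ι) _ _ _ ?_
    rw [(IsOpenQuotientMap.id.prodMap hq).isQuotientMap.continuous_iff]
    exact hq.continuous.comp (continuous_smul (M := ℂ) (X := X)) |>.congr fun p => map_smul _ _ _
  locallyConvexSpace := by
    let _ : TopologicalSpace (LinearMap.range ι) := .coinduced ι.rangeRestrict inferInstance
    have hq := isOpenQuotientMap_rangeRestrict ι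
    refine (locallyConvexSpace_iff_exists_convex_subset ℝ (LinearMap.range ι)).2 ?_
    intro y U hU
    obtain ⟨x, rfl⟩ := hq.surjective y
    obtain ⟨S, hS, hc, hSU⟩ := (locallyConvexSpace_iff_exists_convex_subset ℝ X).1 inferInstance x
      _ (hq.continuous.continuousAt.preimage_mem_nhds hU)
    exact ⟨ι.rangeRestrict '' S, hq.isOpenMap.image_mem_nhds hS,
      hc.linear_image (ι.rangeRestrict.restrictScalars ℝ), Set.image_subset_iff.2 hSU⟩

/-- The strong dual of a locally convex space `X` in which `𝒟(ℝⁿ)` is continuously and densely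
embedded by `j`, as a space of distributions: `u ∈ X'` is the distribution `φ ↦ u(j φ)`. -/
def LCSubspace.strongDual {n : ℕ} (j : Test n →L[ℂ] X) : LCSubspace n ℂ :=
  LCSubspace.ofRange (X := X →L[ℂ] ℂ)
    { toFun := fun u => u.comp j
      map_add' := fun _ _ => rfl
      map_smul' := fun _ _ => rfl }

/-- A linear map from `𝒟(ℝⁿ)` is continuous as soon as on each `𝒟_K` it is bounded by finitely many
derivatives. -/
lemma continuous_of_seminorm_bound {n : ℕ} {ι : Type*} {p : SeminormFamily ℂ X ι}
    (hp : WithSeminorms p) (j : Test n →ₗ[ℂ] X)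
    (h : ∀ (i : ι) (K : Set (Rn n)), IsCompact K → ∃ (N : ℕ) (C : ℝ), 0 ≤ C ∧ ∀ (φ : Test n) (A : ℝ),
      0 ≤ A → tsupport φ ⊆ K → (∀ m ≤ N, ∀ x, ‖iteratedFDeriv ℝ m φ x‖ ≤ A) →
        p i (j φ) ≤ C * A) :
    Continuous j := by
  have := hp.topologicalAddGroup
  have := hp.continuousSMul
  have : LocallyConvexSpace ℝ X := hp.toLocallyConvexSpace
  have := continuousSMul_real X
  rw [TestFunction.continuous_iff_continuous_comp]
  intro K hK
  let jK : 𝓓^{⊤}_{K}(Rn n, ℂ) →ₗ[ℂ] X :=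
    j.comp (TestFunction.ofSupportedInCLM ℂ hK).toLinearMap
  change Continuous jK
  refine (ContDiffMapSupportedIn.withSeminorms ℂ (Rn n) ℂ ⊤ K).continuous_of_isBounded hp jK fun i => ?_
  obtain ⟨N, C, hC, hN⟩ := h i K K.isCompact
  refine ⟨Finset.Iic N, ⟨C, hC⟩, fun f => ?_⟩
  refine hN (TestFunction.ofSupportedIn hK f) _ (apply_nonneg _ _) f.tsupport_subset
    fun m hm x => ?_
  refine (ContDiffMapSupportedIn.norm_iteratedFDeriv_apply_le_seminorm_top ℂ (f := f)).trans ?_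
  exact Seminorm.le_finset_sup_apply (Finset.mem_Iic.2 hm)

end Range

/-- `𝒟(ℝⁿ)` as a space of distributions. -/
def spaceD (n : ℕ) : LCSubspace n ℂ := LCSubspace.ofRange (testToDist n)

/-- `𝒟'(ℝⁿ)`, with the strong topology. -/
def spaceD' (n : ℕ) : LCSubspace n ℂ := LCSubspace.strongDual (ContinuousLinearMap.id ℂ (Test n))

/-- `𝒮(ℝⁿ)` as a space of distributions. -/
def spaceS (n : ℕ) : LCSubspace n ℂ :=
  LCSubspace.ofRange (X := 𝓢(Rn n, ℂ))
    { toFun := fun f => regularDist f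
      map_add' := fun f g => regularDist_add f.continuous g.continuous
      map_smul' := fun c f => regularDist_smul c f.continuous }

/-- The inclusion `𝒟(ℝⁿ) → 𝒮(ℝⁿ)`. -/
def testToSchwartz (n : ℕ) : Test n →L[ℂ] 𝓢(Rn n, ℂ) where
  toFun φ := φ.hasCompactSupport.toSchwartzMap φ.contDiff
  map_add' _ _ := rfl
  map_smul' _ _ := rfl
  cont := by
    refine continuous_of_seminorm_bound (schwartz_withSeminorms ℂ (Rn n) ℂ)
      { toFun := fun φ => φ.hasCompactSupport.toSchwartzMap φ.contDiff
        map_add' := fun _ _ => rfl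
        map_smul' := fun _ _ => rfl } ?_
    rintro ⟨k, l⟩ K hK
    obtain ⟨R, hR⟩ := hK.isBounded.exists_norm_le
    refine ⟨l, |R| ^ k, by positivity, fun φ A hA hφ hD => ?_⟩
    refine SchwartzMap.seminorm_le_bound ℂ k l _ (by positivity) fun x => ?_
    change ‖x‖ ^ k * ‖iteratedFDeriv ℝ l φ x‖ ≤ _
    by_cases hx : x ∈ K
    · have h1 : ‖x‖ ≤ |R| := (hR x hx).trans (le_abs_self R)
      have := hD l le_rfl x
      gcongr
    · have : iteratedFDeriv ℝ l φ x = 0 := by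
        by_contra h
        exact hx (hφ (support_iteratedFDeriv_subset l h))
      rw [this, norm_zero, mul_zero]
      positivity

/-- `𝒮'(ℝⁿ)`, with the strong topology. -/
def spaceS' (n : ℕ) : LCSubspace n ℂ := LCSubspace.strongDual (testToSchwartz n)

/-- The vector space `C^∞(ℝⁿ)`. -/
def smoothSubmodule (n : ℕ) : Submodule ℂ (Rn n → ℂ) where
  carrier := {f | ContDiff ℝ ∞ f}
  add_mem' {f g} (hf : ContDiff ℝ ∞ f) (hg : ContDiff ℝ ∞ g) := (hf.add hg : ContDiff ℝ ∞ (f + g))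
  zero_mem' := (contDiff_const : ContDiff ℝ ∞ fun _ : Rn n => (0 : ℂ))
  smul_mem' c f (hf : ContDiff ℝ ∞ f) := (hf.const_smul c : ContDiff ℝ ∞ (c • f))

/-- The space `𝓔(ℝⁿ) = C^∞(ℝⁿ)`. -/
def Smooth (n : ℕ) : Type := smoothSubmodule n

instance (n : ℕ) : AddCommGroup (Smooth n) := inferInstanceAs (AddCommGroup (smoothSubmodule n))

instance (n : ℕ) : Module ℂ (Smooth n) := inferInstanceAs (Module ℂ (smoothSubmodule n))

/-- The seminorms on `𝓔(ℝⁿ)` that are dominated by the supremum over a compact set of the derivatives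
up to some order. -/
def SmoothSeminorm (n : ℕ) : Type :=
  {q : Seminorm ℂ (Smooth n) // ∃ (K : Set (Rn n)) (N : ℕ) (C : ℝ), IsCompact K ∧ 0 ≤ C ∧
    ∀ (f : Smooth n) (A : ℝ), 0 ≤ A →
      (∀ m ≤ N, ∀ x ∈ K, ‖iteratedFDeriv ℝ m f.1 x‖ ≤ A) → q f ≤ C * A}

instance (n : ℕ) : Nonempty (SmoothSeminorm n) :=
  ⟨⟨0, ∅, 0, 0, isCompact_empty, le_rfl, fun f A _ _ => by simp⟩⟩

/-- `SmoothSeminorm n` as a family of seminorms. -/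
def smoothSeminormFamily (n : ℕ) : SeminormFamily ℂ (Smooth n) (SmoothSeminorm n) :=
  fun q => q.1

/-- The topology of `𝓔(ℝⁿ)`: uniform convergence of all derivatives on compact sets. -/
instance (n : ℕ) : TopologicalSpace (Smooth n) :=
  (smoothSeminormFamily n).moduleFilterBasis.topology

/-- The inclusion `𝒟(ℝⁿ) → 𝓔(ℝⁿ)`. -/
def testToSmooth (n : ℕ) : Test n →L[ℂ] Smooth n where
  toFun φ := ⟨φ, φ.contDiff⟩
  map_add' _ _ := rfl
  map_smul' _ _ := rfl
  cont := by
    refine continuous_of_seminorm_bound (p := smoothSeminormFamily n) ⟨rfl⟩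
      { toFun := fun φ => ⟨φ, φ.contDiff⟩
        map_add' := fun _ _ => rfl
        map_smul' := fun _ _ => rfl } ?_
    rintro ⟨q, K', N, C, hK', hC, hq⟩ K hK
    exact ⟨N, C, hC, fun φ A hA _ hD => hq _ A hA fun m hm x _ => hD m hm x⟩

/-- `𝓔'(ℝⁿ)`, the space of distributions with compact support, as the strong dual of `𝓔(ℝⁿ)`. -/
def spaceE' (n : ℕ) : LCSubspace n ℂ := LCSubspace.strongDual (testToSmooth n)

/-- The derivatives of `f` up to order `N` are bounded by `A (1 + |x|)^k`. -/
def GrowthBound {n : ℕ} (f : Rn n → ℂ) (k N : ℕ) (A : ℝ) : Prop :=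
  ∀ m ≤ N, ∀ x, ‖iteratedFDeriv ℝ m f x‖ ≤ A * (1 + ‖x‖) ^ k

lemma GrowthBound.add {n : ℕ} {f g : Rn n → ℂ} (hf : ContDiff ℝ ∞ f) (hg : ContDiff ℝ ∞ g)
    {k l N : ℕ} {A B : ℝ} (hA : 0 ≤ A) (hB : 0 ≤ B) (h : GrowthBound f k N A)
    (h' : GrowthBound g l N B) : GrowthBound (f + g) (max k l) N (A + B) := by
  intro m hm x
  have hx : 1 ≤ 1 + ‖x‖ := by linarith [norm_nonneg x]
  rw [iteratedFDeriv_add_apply (hf.of_le (mod_cast le_top)).contDiffAt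
    (hg.of_le (mod_cast le_top)).contDiffAt, add_mul]
  refine (norm_add_le _ _).trans (add_le_add ((h m hm x).trans ?_) ((h' m hm x).trans ?_))
  · gcongr
    exact le_max_left _ _
  · gcongr
    exact le_max_right _ _

/-- The vector space `𝓞_C(ℝⁿ)` of all smooth functions `f` for which there is a `k` such that all
derivatives of `f` are `O((1 + |x|)^k)`. -/
def ocSubmodule (n : ℕ) : Submodule ℂ (Rn n → ℂ) where
  carrier := {f | ContDiff ℝ ∞ f ∧ ∃ k : ℕ, ∀ N, ∃ A, 0 ≤ A ∧ GrowthBound f k N A}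
  add_mem' := by
    rintro f g ⟨hf, k, hk⟩ ⟨hg, l, hl⟩
    refine ⟨hf.add hg, max k l, fun N => ?_⟩
    obtain ⟨A, hA, h⟩ := hk N
    obtain ⟨B, hB, h'⟩ := hl N
    exact ⟨A + B, add_nonneg hA hB, h.add hf hg hA hB h'⟩
  zero_mem' := by
    refine ⟨contDiff_const, 0, fun N => ⟨0, le_rfl, fun m _ x => ?_⟩⟩
    have : iteratedFDeriv ℝ m (0 : Rn n → ℂ) x = 0 := by
      simp [Pi.zero_def]
    simp [this]
  smul_mem' := by
    rintro c f ⟨hf, k, hk⟩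
    refine ⟨hf.const_smul c, k, fun N => ?_⟩
    obtain ⟨A, hA, h⟩ := hk N
    refine ⟨‖c‖ * A, by positivity, fun m hm x => ?_⟩
    rw [iteratedFDeriv_const_smul_apply (hf.of_le (mod_cast le_top)).contDiffAt, norm_smul,
      mul_assoc]
    gcongr
    exact h m hm x

/-- The space `𝓞_C(ℝⁿ)` of very slowly increasing smooth functions. -/
def OC (n : ℕ) : Type := ocSubmodule n

instance (n : ℕ) : AddCommGroup (OC n) := inferInstanceAs (AddCommGroup (ocSubmodule n))

instance (n : ℕ) : Module ℂ (OC n) := inferInstanceAs (Module ℂ (ocSubmodule n))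

/-- The seminorms on `𝓞_C(ℝⁿ)` whose restriction to each step
`𝓞_C^k = {f | ∀ m, sup (1 + |x|)^(-k) |D^m f(x)| < ∞}` is continuous. -/
def OCSeminorm (n : ℕ) : Type :=
  {q : Seminorm ℂ (OC n) // ∀ k : ℕ, ∃ (N : ℕ) (C : ℝ), 0 ≤ C ∧
    ∀ (f : OC n) (A : ℝ), (∀ M, ∃ B, GrowthBound f.1 k M B) → 0 ≤ A → GrowthBound f.1 k N A →
      q f ≤ C * A}

instance (n : ℕ) : Nonempty (OCSeminorm n) :=
  ⟨⟨0, fun _ => ⟨0, 0, le_rfl, fun f A _ _ _ => by simp⟩⟩⟩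

/-- `OCSeminorm n` as a family of seminorms. -/
def ocSeminormFamily (n : ℕ) : SeminormFamily ℂ (OC n) (OCSeminorm n) := fun q => q.1

/-- The topology of `𝓞_C(ℝⁿ)` as the locally convex inductive limit of the spaces `𝓞_C^k`. -/
instance (n : ℕ) : TopologicalSpace (OC n) := (ocSeminormFamily n).moduleFilterBasis.topology

lemma test_growthBound {n : ℕ} (φ : Test n) (N : ℕ) : ∃ A, 0 ≤ A ∧ GrowthBound φ 0 N A := by
  have hb : ∀ m : ℕ, ∃ A, ∀ x, ‖iteratedFDeriv ℝ m φ x‖ ≤ A := fun m =>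
    ((φ.contDiff.continuous_iteratedFDeriv
      (mod_cast le_top)).bounded_above_of_compact_support (φ.hasCompactSupport.iteratedFDeriv m))
  choose A hA using hb
  have hA0 : ∀ m, 0 ≤ A m := fun m => (norm_nonneg _).trans (hA m 0)
  refine ⟨∑ m ∈ Finset.range (N + 1), A m, Finset.sum_nonneg fun m _ => hA0 m, fun m hm x => ?_⟩
  rw [pow_zero, mul_one]
  exact (hA m x).trans (Finset.single_le_sum (f := A) (fun i _ => hA0 i)
    (Finset.mem_range.2 (Nat.lt_succ_of_le hm)))

/-- The inclusion `𝒟(ℝⁿ) → 𝓞_C(ℝⁿ)`. -/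
def testToOC (n : ℕ) : Test n →L[ℂ] OC n where
  toFun φ := ⟨φ, φ.contDiff, 0, test_growthBound φ⟩
  map_add' _ _ := rfl
  map_smul' _ _ := rfl
  cont := by
    refine continuous_of_seminorm_bound (p := ocSeminormFamily n) ⟨rfl⟩
      { toFun := fun φ => ⟨φ, φ.contDiff, 0, test_growthBound φ⟩
        map_add' := fun _ _ => rfl
        map_smul' := fun _ _ => rfl } ?_
    rintro ⟨q, hq⟩ K hK
    obtain ⟨N, C, hC, h⟩ := hq 0
    refine ⟨N, C, hC, fun φ A hA _ hD => h _ A (fun M => ?_) hA fun m hm x => ?_⟩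
    · obtain ⟨B, -, hB⟩ := test_growthBound φ M
      exact ⟨B, hB⟩
    · rw [pow_zero, mul_one]
      exact hD m hm x

/-- `𝓞'_C(ℝⁿ)`, the space of rapidly decreasing distributions, as the strong dual of `𝓞_C(ℝⁿ)`. -/
def spaceOC' (n : ℕ) : LCSubspace n ℂ := LCSubspace.strongDual (testToOC n)

end VVDist

end

/-!
# Vector-valued multiplier spaces

Let `𝓜 = 𝓞_M(𝓚, 𝓛)`. An element `S` of `𝓜(V)` is the same as a continuous map `e ↦ ⟨S, e⟩` from
`V'_c` to `𝓜 ⊆ L_c(𝓚, 𝓛)`, and an element of `𝓞_M(𝓚, 𝓛(V))` is the same as a continuous map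
`k ↦ [S] k` from `𝓚` to `𝓛(V) = L_ε(V'_c, 𝓛)`. The two correspond to each other by
`([S] k)(e) = [⟨S, e⟩] k`, so both are separately continuous bilinear maps `𝓚 × V'_c → 𝓛`, with the
same topology of uniform convergence on the products of absolutely convex compact sets in `𝓚` and
equicontinuous sets in `V'`. What has to be shown is that each kind of continuity implies the other.

* From `𝓜(V)` to `𝓞_M(𝓚, 𝓛(V))`: equicontinuous sets in `V'` lie in compact subsets of `V'_c`
  (Alaoglu, `isCompact_polarBall`), hence have compact images in `L_c(𝓚, 𝓛)`. A compact set `H` of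
  operators is equicontinuous, because `(h, l) ↦ l ∘ h` is continuous on the product of `H` with an
  equicontinuous set of functionals, so that the functionals `l ∘ h` form a compact set in `𝓚'_c`;
  by the convex compactness property it lies in an absolutely convex compact set, which is
  equicontinuous because `𝓚` carries the topology `γ` (`equicontinuous_of_isCompact`).
* From `𝓞_M(𝓚, 𝓛(V))` to `𝓜(V)`: an absolutely convex compact set in `𝓚` has a compact image in
  `L_ε(V'_c, 𝓛)`. By the same argument, the functionals `l ∘ h` form a compact set in
  `L_ε(V'_c, ℂ)`, which is `V` itself by the Mackey–Arens theorem (`exists_eval_of_continuous`), and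
  the convex compactness property of `V` encloses it in an absolutely convex compact set, that is, in
  a set on which the topology of `V'_c` gives uniform convergence
  (`exists_absConvexCompact_transpose`).

Both concrete identities are of the form `X'(V) = 𝓞_M(X, Y'(V))`, where `(X, Y)` is `(𝒟, 𝓔)` or
`(𝒮, 𝓞_C)`. Here `V` need not have the convex compactness property. In its place one uses that `X` is
bornological, so that the elements of `X'(V)` are the continuous linear maps `R : X → V`, and that
`X` is a Montel space, so that each such `R` maps bounded sets into absolutely convex compact sets.
The multiplication operator of `R` is `x ↦ (y ↦ R (x y))`, and `R` is recovered from the operator by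
inserting `y = 1 ∈ Y`; the correspondence is topological because multiplication `X × Y → X` maps
products of bounded sets to bounded sets. The properties of the pair `(X, Y)` that enter are collected
in `IsMultiplierPair`, and the identity is `IsMultiplierPair.vec_strongDual_eq_OM`. The Montel property
of `𝒮` is a normal family argument for smooth functions (`exists_limit_schwartzBall`); that of `𝒟`
follows because bounded sets in `𝒟` have their supports in a common compact set. The density
statements rest on cut-off functions that are dilations of a single function and therefore tend to `1`
in `𝓞_C` (`tendsto_cutTest_oc`).
-/

open scoped Topology Distributions SchwartzMap ContDiff

noncomputable section

set_option linter.unusedSectionVars false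

namespace VVDist

open Filter Set Bornology Topology

/-! ### Seminorms, polars and the duality of `V` and `V'_c` -/

section Seminorms

variable (V : Type*) [AddCommGroup V] [Module ℂ V] [TopologicalSpace V]
  [IsTopologicalAddGroup V] [ContinuousSMul ℂ V] [LocallyConvexSpace ℝ V]

open scoped ComplexOrder in
/-- The topology of a locally convex space over `ℂ` is given by `ℂ`-seminorms. -/
lemma polynormableSpace_complex : PolynormableSpace ℂ V := by
  have : LocallyConvexSpace ℂ V := by
    refine ⟨fun x => ?_⟩
    simp_rw [convex_RCLike_iff_convex_real]
    exact LocallyConvexSpace.convex_basis x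
  have : ContinuousSMul ℝ V := continuousSMul_real V
  exact LocallyConvexSpace.toPolynormableSpace

variable {V}

lemma exists_seminorm_of_mem_nhds {U : Set V} (hU : U ∈ 𝓝 0) :
    ∃ p : Seminorm ℂ V, Continuous p ∧ ∀ x, p x < 1 → x ∈ U := by
  have := polynormableSpace_complex V
  obtain ⟨s, r, hr, h⟩ := (PolynormableSpace.withSeminorms ℂ V).mem_nhds_iff 0 U |>.1 hU
  have hcont : Continuous (s.sup fun p : {p : Seminorm ℂ V // Continuous p} => p.1 :
      Seminorm ℂ V) := Seminorm.continuous_finsetSup fun p _ => p.2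
  let c : NNReal := ⟨r⁻¹, by positivity⟩
  refine ⟨c • s.sup fun p : {p : Seminorm ℂ V // Continuous p} => p.1,
    hcont.const_smul c, fun x hx => h ?_⟩
  rw [Seminorm.mem_ball_zero]
  change r⁻¹ * _ < 1 at hx
  rwa [inv_mul_lt_iff₀ hr, mul_one] at hx

end Seminorms

section Polar

variable {V : Type*} [AddCommGroup V] [Module ℂ V] [TopologicalSpace V]

/-- The polar of the unit ball of a seminorm `p`: all functionals dominated by `p`. -/
def polarBall (p : Seminorm ℂ V) : Set (DualC V) := {e | ∀ x, ‖e x‖ ≤ p x}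

lemma balanced_polarBall (p : Seminorm ℂ V) : Balanced ℂ (polarBall p) := by
  rintro a ha _ ⟨e, he, rfl⟩ x
  change ‖a • e x‖ ≤ p x
  rw [norm_smul]
  exact (mul_le_of_le_one_left (norm_nonneg _) ha).trans (he x)

lemma convex_polarBall (p : Seminorm ℂ V) : Convex ℝ (polarBall p) := by
  intro e he f hf a b ha hb hab x
  change ‖a • e x + b • f x‖ ≤ p x
  refine (norm_add_le _ _).trans ?_
  rw [norm_smul, norm_smul, Real.norm_of_nonneg ha, Real.norm_of_nonneg hb]
  calc _ ≤ a * p x + b * p x := by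
        gcongr
        · exact he x
        · exact hf x
    _ = p x := by rw [← add_mul, hab, one_mul]

lemma eventually_seminorm_lt {p : Seminorm ℂ V} (hp : Continuous p) {r : ℝ} (hr : 0 < r) :
    ∀ᶠ x in 𝓝 (0 : V), p x < r :=
  hp.continuousAt.eventually_lt continuousAt_const (by simpa using hr)

variable [IsTopologicalAddGroup V] [ContinuousSMul ℂ V]

lemma polarBall_mem_equicontinuousSets {p : Seminorm ℂ V} (hp : Continuous p) :
    polarBall p ∈ equicontinuousSets V :=
  ⟨{x | p x < 1}, eventually_seminorm_lt hp one_pos, fun _ he x hx => (he x).trans (le_of_lt hx)⟩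

lemma exists_polarBall_superset [LocallyConvexSpace ℝ V] {A : Set (DualC V)}
    (hA : A ∈ equicontinuousSets V) : ∃ p : Seminorm ℂ V, Continuous p ∧ A ⊆ polarBall p := by
  obtain ⟨U, hU, hA⟩ := hA
  obtain ⟨p, hp, hpU⟩ := exists_seminorm_of_mem_nhds hU
  refine ⟨p, hp, fun e he x => ?_⟩
  refine le_of_forall_pos_le_add fun ε hε => ?_
  have hpos : 0 < p x + ε := by positivity
  have hx : ((p x + ε : ℝ) : ℂ)⁻¹ • x ∈ U := by
    apply hpU
    rw [map_smul_eq_mul, norm_inv, Complex.norm_real, Real.norm_of_nonneg hpos.le,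
      inv_mul_lt_iff₀ hpos]
    linarith
  have := hA e he _ hx
  rw [map_smul, norm_smul, norm_inv, Complex.norm_real, Real.norm_of_nonneg hpos.le,
    inv_mul_le_iff₀ hpos, mul_one] at this
  exact this

/-- The Hahn–Banach theorem. -/
lemma exists_dual_apply_eq [LocallyConvexSpace ℝ V] {p : Seminorm ℂ V} (hp : Continuous p)
    (x : V) : ∃ e ∈ polarBall p, e x = p x := by
  have := polynormableSpace_complex V
  by_cases hx : x = 0
  · refine ⟨0, fun y => ?_, ?_⟩
    · rw [zero_apply, norm_zero]
      exact apply_nonneg p y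
    · rw [zero_apply, hx, map_zero, Complex.ofReal_zero]
  · let f : Module.Dual ℂ (Submodule.span ℂ {x}) :=
      ((p x : ℝ) : ℂ) • (LinearEquiv.toSpanNonzeroSingleton ℂ V x hx).symm.toLinearMap
    have hfx : ∀ c, f (LinearEquiv.toSpanNonzeroSingleton ℂ V x hx c) = p x * c := fun c =>
      congrArg (fun z : ℂ => (p x : ℂ) * z) (LinearEquiv.symm_apply_apply _ c)
    have hf : ∀ y, ‖f y‖ ≤ p y := by
      intro y
      obtain ⟨c, rfl⟩ := (LinearEquiv.toSpanNonzeroSingleton ℂ V x hx).surjective y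
      rw [hfx, LinearEquiv.toSpanNonzeroSingleton_apply, map_smul_eq_mul, norm_mul,
        Complex.norm_real, Real.norm_of_nonneg (apply_nonneg p x), mul_comm]
    obtain ⟨g, hg, hgp⟩ := Module.Dual.exists_continuous_extension_of_le_seminorm _ f hp hf
    refine ⟨g, hgp, ?_⟩
    have : g ((1 : ℂ) • x) = p x * 1 :=
      (hg (LinearEquiv.toSpanNonzeroSingleton ℂ V x hx 1)).trans (hfx 1)
    rwa [one_smul, mul_one] at this

lemma seminorm_le_of_forall_dual [LocallyConvexSpace ℝ V] {p : Seminorm ℂ V} (hp : Continuous p)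
    {x : V} {r : ℝ} (h : ∀ e ∈ polarBall p, ‖e x‖ ≤ r) : p x ≤ r := by
  obtain ⟨e, he, hex⟩ := exists_dual_apply_eq hp x
  have := h e he
  rwa [hex, Complex.norm_real, Real.norm_of_nonneg (apply_nonneg p x)] at this

lemma eq_of_forall_dual [LocallyConvexSpace ℝ V] [T1Space V] {x y : V}
    (h : ∀ e : DualC V, e x = e y) : x = y := by
  by_contra hne
  have hU : {z | z ≠ x - y} ∈ 𝓝 (0 : V) := isOpen_ne.mem_nhds (sub_ne_zero.2 hne).symm
  obtain ⟨p, hp, hpU⟩ := exists_seminorm_of_mem_nhds hU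
  refine hpU (x - y) ?_ rfl
  refine (seminorm_le_of_forall_dual hp (r := 0) fun e _ => ?_).trans_lt one_pos
  rw [map_sub, h e, sub_self, norm_zero]

end Polar

section DualTopology

variable {V : Type*} [AddCommGroup V] [Module ℂ V] [TopologicalSpace V]

lemma exists_mem_absConvexCompacts [ContinuousSMul ℂ V] (x : V) :
    ∃ C ∈ absConvexCompacts V, x ∈ C := by
  refine ⟨(fun c : ℂ => c • x) '' Metric.closedBall 0 1, ⟨?_, ?_, ?_⟩, 1, by simp, one_smul _ _⟩
  · rintro a ha _ ⟨_, ⟨c, hc, rfl⟩, rfl⟩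
    refine ⟨a * c, ?_, mul_smul _ _ _⟩
    simp only [Metric.mem_closedBall, dist_zero_right, norm_mul] at hc ⊢
    exact mul_le_one₀ ha (norm_nonneg _) hc
  · exact (convex_closedBall (0 : ℂ) 1).linear_image
      ((LinearMap.toSpanSingleton ℂ V x).restrictScalars ℝ)
  · exact (isCompact_closedBall (0 : ℂ) 1).image (continuous_id.smul continuous_const)

lemma sUnion_absConvexCompacts [ContinuousSMul ℂ V] : ⋃₀ absConvexCompacts V = univ :=
  eq_univ_of_forall fun x =>
    let ⟨C, hC, hx⟩ := exists_mem_absConvexCompacts x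
    ⟨C, hC, hx⟩

lemma absConvexCompacts_nonempty : (absConvexCompacts V).Nonempty :=
  ⟨∅, balanced_empty, convex_empty, isCompact_empty⟩

open scoped Pointwise in
lemma absConvexCompacts_directed [IsTopologicalAddGroup V] :
    DirectedOn (· ⊆ ·) (absConvexCompacts V) := by
  rintro A hA B hB
  rcases A.eq_empty_or_nonempty with rfl | hA0
  · exact ⟨B, hB, empty_subset _, subset_rfl⟩
  rcases B.eq_empty_or_nonempty with rfl | hB0
  · exact ⟨A, hA, subset_rfl, empty_subset _⟩
  refine ⟨A + B, ⟨hA.1.add hB.1, hA.2.1.add hB.2.1, hA.2.2.add hB.2.2⟩, fun x hx => ?_,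
    fun x hx => ?_⟩
  · exact ⟨x, hx, 0, hB.1.zero_mem hB0, add_zero x⟩
  · exact ⟨0, hA.1.zero_mem hA0, x, hx, zero_add x⟩

lemma absConvexCompacts_image {W : Type*} [AddCommGroup W] [Module ℂ W] [TopologicalSpace W]
    (f : V →L[ℂ] W) {C : Set V} (hC : C ∈ absConvexCompacts V) : f '' C ∈ absConvexCompacts W :=
  ⟨fun a ha => by
      rw [← image_smul_comm f a C fun _ => map_smul f _ _]
      exact image_mono (hC.1 a ha),
    hC.2.1.linear_image (f.toLinearMap.restrictScalars ℝ), hC.2.2.image f.continuous⟩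

variable [IsTopologicalAddGroup V] [ContinuousSMul ℂ V]

lemma continuous_dualC_apply (x : V) : Continuous fun e : DualC V => e x :=
  have := UniformConvergenceCLM.continuousEvalConst (RingHom.id ℂ) ℂ (absConvexCompacts V)
    sUnion_absConvexCompacts
  continuous_eval_const x

lemma isVonNBounded_of_isCompact {C : Set V} (hC : IsCompact C) : IsVonNBounded ℂ C := by
  let _ : UniformSpace V := IsTopologicalAddGroup.rightUniformSpace V
  have : IsUniformAddGroup V := isUniformAddGroup_of_addCommGroup
  exact hC.totallyBounded.isVonNBounded ℂ

instance : ContinuousSMul ℂ (DualC V) :=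
  UniformConvergenceCLM.continuousSMul _ _ _ fun _ h => isVonNBounded_of_isCompact h.2.2

instance {W : Type*} [AddCommGroup W] [Module ℂ W] [TopologicalSpace W] [IsTopologicalAddGroup W]
    [ContinuousSMul ℂ W] : ContinuousSMul ℂ (LinC V W) :=
  UniformConvergenceCLM.continuousSMul _ _ _ fun _ h => isVonNBounded_of_isCompact h.2.2

/-- Alaoglu's theorem: on an equicontinuous set pointwise convergence implies uniform convergence on
compact sets, so polars of neighbourhoods are compact in `V'_c` and not only weak-* compact. -/
lemma isCompact_polarBall {p : Seminorm ℂ V} (hp : Continuous p) :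
    IsCompact (polarBall p) := by
  rw [isCompact_iff_ultrafilter_le_nhds]
  intro 𝒰 h𝒰
  rw [le_principal_iff] at h𝒰
  have hlim : ∀ x : V, ∃ y : ℂ, ‖y‖ ≤ p x ∧ Tendsto (fun e : DualC V => e x) 𝒰 (𝓝 y) := by
    intro x
    have hmem : Metric.closedBall (0 : ℂ) (p x) ∈ 𝒰.map fun e : DualC V => e x := by
      rw [Ultrafilter.mem_map]
      refine mem_of_superset h𝒰 fun e he => ?_
      simpa using he x
    obtain ⟨y, hy, hle⟩ := (isCompact_closedBall (0 : ℂ) (p x)).ultrafilter_le_nhds _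
      (le_principal_iff.2 hmem)
    exact ⟨y, by simpa using hy, hle⟩
  choose g hgp hg using hlim
  let gl : V →ₗ[ℂ] ℂ :=
    { toFun := g
      map_add' := fun x y => tendsto_nhds_unique
        (hg (x + y)) (((hg x).add (hg y)).congr fun e => (map_add e x y).symm)
      map_smul' := fun c x => tendsto_nhds_unique
        (hg (c • x)) (((hg x).const_smul c).congr fun e => (map_smul e c x).symm) }
  have hglc : Continuous gl := by
    refine continuous_of_continuousAt_zero gl ?_
    rw [ContinuousAt, map_zero]
    refine squeeze_zero_norm (fun x => hgp x) ?_
    simpa using hp.tendsto 0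
  let G : DualC V := (⟨gl, hglc⟩ : V →L[ℂ] ℂ)
  refine ⟨G, fun x => hgp x, ?_⟩
  have : Tendsto (fun e : DualC V => e) 𝒰 (𝓝 G) := by
    rw [UniformConvergenceCLM.tendsto_iff_tendstoUniformlyOn]
    rintro C ⟨-, -, hC⟩
    rw [Metric.tendstoUniformlyOn_iff]
    intro ε hε
    have hε4 : 0 < ε / 4 := by positivity
    -- Cover `C` by finitely many translates of the `p`-ball of radius `ε / 4`.
    obtain ⟨t, -, ht⟩ := hC.elim_nhds_subcover (fun x => {y | p (y - x) < ε / 4}) fun x _ => by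
      have h1 : Tendsto (fun y => p (y - x)) (𝓝 x) (𝓝 0) := by
        refine (hp.comp (continuous_id.sub (continuous_const (y := x)))).tendsto' x 0 ?_
        simp
      exact h1.eventually_lt_const hε4
    have hev : ∀ᶠ e : DualC V in (𝒰 : Filter (DualC V)), ∀ x ∈ t, ‖g x - e x‖ < ε / 4 := by
      rw [t.eventually_all]
      intro x _
      have := ((tendsto_const_nhds (x := g x)).sub (hg x)).norm
      rw [sub_self, norm_zero] at this
      exact this.eventually_lt_const hε4
    filter_upwards [hev, h𝒰] with e he hep y hy
    obtain ⟨x, hxt, hx⟩ := mem_iUnion₂.1 (ht hy)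
    change p (y - x) < ε / 4 at hx
    change dist (g y) (e y) < ε
    have h1 : g y - e y = g (y - x) + (g x - e x) - e (y - x) := by
      have : g (y - x) = g y - g x := map_sub gl y x
      rw [this, map_sub]
      ring
    rw [dist_eq_norm, h1]
    calc _ ≤ ‖g (y - x)‖ + ‖g x - e x‖ + ‖e (y - x)‖ :=
          (norm_sub_le _ _).trans (by gcongr; exact norm_add_le _ _)
      _ < ε := by linarith [hgp (y - x), hep (y - x), he x hxt]
  exact this

/-- The polars of absolutely convex compact sets form a neighbourhood basis of `0` in `V'_c`. -/
lemma exists_absConvexCompact_of_mem_nhds {W : Set (DualC V)} (hW : W ∈ 𝓝 0) :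
    ∃ C ∈ absConvexCompacts V, (0 : V) ∈ C ∧ ∀ e : DualC V, (∀ x ∈ C, ‖e x‖ < 1) → e ∈ W := by
  obtain ⟨⟨C, U⟩, ⟨hC, hU⟩, hCW⟩ := (UniformConvergenceCLM.hasBasis_nhds_zero (RingHom.id ℂ) ℂ
    (absConvexCompacts V) absConvexCompacts_nonempty absConvexCompacts_directed).mem_iff.1 hW
  obtain ⟨δ, hδ, hδU⟩ := Metric.mem_nhds_iff.1 hU
  have hδ0 : (δ : ℂ) ≠ 0 := by exact_mod_cast hδ.ne'
  obtain ⟨Z, hZ, h0⟩ := exists_mem_absConvexCompacts (0 : V)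
  obtain ⟨D, hD, hCD, hZD⟩ := absConvexCompacts_directed C hC Z hZ
  let f : V →L[ℂ] V := (δ : ℂ)⁻¹ • ContinuousLinearMap.id ℂ V
  refine ⟨f '' D, absConvexCompacts_image f hD, ⟨0, hZD h0, map_zero f⟩, fun e he =>
    hCW fun x hx => hδU ?_⟩
  have := he _ (mem_image_of_mem f (hCD hx))
  change ‖e ((δ : ℂ)⁻¹ • x)‖ < 1 at this
  rw [map_smul, norm_smul, norm_inv, Complex.norm_real, Real.norm_of_nonneg hδ.le,
    inv_mul_lt_iff₀ hδ, mul_one] at this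
  simpa using this

/-- The Mackey–Arens theorem for the topology of `V'_c`: every continuous functional on `V'_c` is
the evaluation at a point of `V`. -/
lemma exists_eval_of_continuous (F : DualC V →L[ℂ] ℂ) :
    ∃ x : V, ∀ e : DualC V, F e = e x := by
  obtain ⟨C, hC, h0, hCF⟩ := exists_absConvexCompact_of_mem_nhds
    (F.continuous.tendsto' 0 0 (map_zero F) (Metric.ball_mem_nhds (0 : ℂ) one_pos))
  -- The image of `C` in the algebraic dual of `V'` is weakly compact, so `F` can be separated
  -- from it by a point of `V'` if it does not belong to it.
  let B : Module.Dual ℂ (DualC V) →ₗ[ℂ] DualC V →ₗ[ℂ] ℂ := LinearMap.id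
  have hB : Function.Injective B := fun _ _ h => h
  have : T2Space (WeakBilin B) := (WeakBilin.isEmbedding hB).t2Space
  let ev : V →ₗ[ℂ] WeakBilin B :=
    { toFun := fun x =>
        ({ toFun := fun e => e x
           map_add' := fun _ _ => rfl
           map_smul' := fun _ _ => rfl } : Module.Dual ℂ (DualC V))
      map_add' := fun x y => LinearMap.ext fun e : DualC V => map_add e x y
      map_smul' := fun c x => LinearMap.ext fun e : DualC V => map_smul e c x }
  have hevc : Continuous ev := WeakBilin.continuous_of_continuous_eval B fun e =>
    (map_continuous e : Continuous e)
  by_contra! hne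
  have hFK : (F.toLinearMap : WeakBilin B) ∉ ev '' C := by
    rintro ⟨x, hx, h⟩
    obtain ⟨e, he⟩ := hne x
    exact he (LinearMap.congr_fun h.symm e)
  obtain ⟨f, u, hfu, huF⟩ := RCLike.geometric_hahn_banach_closed_point (𝕜 := ℂ)
    (hC.2.1.linear_image (ev.restrictScalars ℝ)) (hC.2.2.image hevc).isClosed hFK
  obtain ⟨e₀, rfl⟩ := LinearMap.dualEmbedding_surjective B f
  have hfu' : ∀ x ∈ C, (e₀ x).re < u := fun x hx => hfu _ (mem_image_of_mem ev hx)
  have huF' : u < (F e₀).re := huF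
  have hu : 0 < u := by simpa using hfu' 0 h0
  have hnorm : ∀ x ∈ C, ‖((u : ℂ)⁻¹ • e₀) x‖ < 1 := by
    intro x hx
    obtain ⟨c, hc, hcx⟩ : ∃ c : ℂ, ‖c‖ ≤ 1 ∧ c * e₀ x = ‖e₀ x‖ := by
      refine ⟨(starRingEnd ℂ) (e₀ x) / ‖e₀ x‖, ?_, ?_⟩
      · rw [norm_div, RCLike.norm_conj, Complex.norm_real, norm_norm]
        exact div_self_le_one _
      · rcases eq_or_ne (e₀ x) 0 with h | h
        · simp [h]
        · have hn : ((‖e₀ x‖ : ℝ) : ℂ) ≠ 0 := by simpa using h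
          rw [div_mul_eq_mul_div, mul_comm, Complex.mul_conj, Complex.normSq_eq_norm_sq]
          field_simp
          push_cast
          ring
    have := hfu' (c • x) (hC.1 c hc (smul_mem_smul_set hx))
    rw [map_smul, smul_eq_mul, hcx, Complex.ofReal_re] at this
    rwa [smul_apply, norm_smul, norm_inv, Complex.norm_real, Real.norm_of_nonneg hu.le,
      inv_mul_lt_iff₀ hu, mul_one]
  have h1 : ‖F ((u : ℂ)⁻¹ • e₀)‖ < 1 := by simpa using hCF _ hnorm
  rw [map_smul, norm_smul, norm_inv, Complex.norm_real, Real.norm_of_nonneg hu.le,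
      inv_mul_lt_iff₀ hu, mul_one] at h1
  linarith [Complex.re_le_norm (F e₀)]

end DualTopology

/-! ### Compact sets of operators and their transposes -/

section Transpose

variable {F L V : Type*} [AddCommGroup F] [Module ℂ F] [TopologicalSpace F]
  [AddCommGroup L] [Module ℂ L] [TopologicalSpace L] [IsTopologicalAddGroup L]
  [ContinuousSMul ℂ L]
  [AddCommGroup V] [Module ℂ V] [TopologicalSpace V] [IsTopologicalAddGroup V]
  [ContinuousSMul ℂ V]

/-- The composition `l ∘ h` of an operator `h : F → L` with a functional `l` on `L`. -/
def dualComp {𝔖 : Set (Set F)} (h : UniformConvergenceCLM (RingHom.id ℂ) L 𝔖) (l : DualC L) :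
    UniformConvergenceCLM (RingHom.id ℂ) ℂ 𝔖 :=
  ContinuousLinearMap.comp (l : L →L[ℂ] ℂ) (h : F →L[ℂ] L)

lemma dualComp_apply {𝔖 : Set (Set F)} (h : UniformConvergenceCLM (RingHom.id ℂ) L 𝔖)
    (l : DualC L) (x : F) : dualComp h l x = l (h x) := rfl

/-- Composition `(h, l) ↦ l ∘ h` is jointly continuous as long as `l` stays in an equicontinuous
set, if all operators `h` map the members of `𝔖` into absolutely convex compact sets. -/
lemma continuousOn_comp_polarBall (𝔖 : Set (Set F))
    (h𝔖 : ∀ C ∈ 𝔖, ∀ h : UniformConvergenceCLM (RingHom.id ℂ) L 𝔖,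
      ∃ D ∈ absConvexCompacts L, h '' C ⊆ D)
    {p : Seminorm ℂ L} (hp : Continuous p) :
    ContinuousOn (fun q : UniformConvergenceCLM (RingHom.id ℂ) L 𝔖 × DualC L =>
      dualComp q.1 q.2) (univ ×ˢ polarBall p) := by
  rintro ⟨h₀, l₀⟩ ⟨-, hl₀⟩
  rw [ContinuousWithinAt, UniformConvergenceCLM.tendsto_iff_tendstoUniformlyOn]
  intro C hC
  rw [Metric.tendstoUniformlyOn_iff]
  intro ε hε
  have hε2 : 0 < ε / 2 := by positivity
  obtain ⟨D, hD, hCD⟩ := h𝔖 C hC h₀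
  have h1 : ∀ᶠ q : UniformConvergenceCLM (RingHom.id ℂ) L 𝔖 × DualC L in 𝓝 (h₀, l₀),
      MapsTo (q.1 - h₀) C {x | p x < ε / 2} := by
    have ht : Tendsto (fun q : UniformConvergenceCLM (RingHom.id ℂ) L 𝔖 × DualC L => q.1 - h₀)
        (𝓝 (h₀, l₀)) (𝓝 0) :=
      (continuous_fst.sub continuous_const).tendsto' _ _ (sub_self _)
    exact ht.eventually (UniformConvergenceCLM.eventually_nhds_zero_mapsTo _ hC
      (eventually_seminorm_lt hp hε2))
  have h2 : ∀ᶠ q : UniformConvergenceCLM (RingHom.id ℂ) L 𝔖 × DualC L in 𝓝 (h₀, l₀),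
      MapsTo (q.2 - l₀) D (Metric.ball 0 (ε / 2)) := by
    have ht : Tendsto (fun q : UniformConvergenceCLM (RingHom.id ℂ) L 𝔖 × DualC L => q.2 - l₀)
        (𝓝 (h₀, l₀)) (𝓝 0) :=
      (continuous_snd.sub continuous_const).tendsto' _ _ (sub_self _)
    exact ht.eventually (UniformConvergenceCLM.eventually_nhds_zero_mapsTo _ hD
      (Metric.ball_mem_nhds 0 hε2))
  filter_upwards [nhdsWithin_le_nhds h1, nhdsWithin_le_nhds h2, self_mem_nhdsWithin] with
    ⟨h, l⟩ hq1 hq2 hl x hx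
  change dist (l₀ (h₀ x)) (l (h x)) < ε
  have e1 : p (h x - h₀ x) < ε / 2 := hq1 hx
  have e2 : l (h₀ x) - l₀ (h₀ x) ∈ Metric.ball (0 : ℂ) (ε / 2) := hq2 (hCD (mem_image_of_mem _ hx))
  rw [mem_ball_zero_iff] at e2
  rw [dist_comm, dist_eq_norm]
  have e3 : l (h x) - l₀ (h₀ x) = l (h x - h₀ x) + (l (h₀ x) - l₀ (h₀ x)) := by
    rw [map_sub]
    ring
  rw [e3]
  refine (norm_add_le _ _).trans_lt ?_
  linarith [(hl.2 : l ∈ polarBall p) (h x - h₀ x)]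

/-- If `F` carries the topology `γ` and `F'_c` has the convex compactness property, then every
compact set of operators `F → L` is equicontinuous. -/
lemma equicontinuous_of_isCompact [IsTopologicalAddGroup F] [ContinuousSMul ℂ F]
    [LocallyConvexSpace ℝ L] (hγ : HasTopologyGamma F)
    (hcc : ConvexCompactness (DualC F)) {H : Set (LinC F L)} (hH : IsCompact H)
    {p : Seminorm ℂ L} (hp : Continuous p) :
    ∀ᶠ k in 𝓝 (0 : F), ∀ h ∈ H, p (h k) ≤ 1 := by
  have hc := continuousOn_comp_polarBall (F := F) (absConvexCompacts F)
    (fun C hC h => ⟨_, absConvexCompacts_image (h : F →L[ℂ] L) hC, subset_rfl⟩) hp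
  have hcomp := (hH.prod (isCompact_polarBall hp)).image_of_continuousOn
    (hc.mono (prod_mono (subset_univ _) subset_rfl))
  obtain ⟨C, hC, hsub⟩ := hcc _ hcomp
  obtain ⟨U, hU, hCU⟩ := hγ hC
  filter_upwards [hU] with k hk h hh
  exact seminorm_le_of_forall_dual hp fun l hl =>
    hCU _ (hsub (mem_image_of_mem _ (mk_mem_prod hh hl))) k hk

/-- The canonical map of `V` into `(V'_c)'`, with the topology of uniform convergence on the
equicontinuous sets; it is an isomorphism for locally convex `V`. -/
def evalEps : V →ₗ[ℂ] EpsProd V ℂ where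
  toFun x :=
    ({ toFun := fun e => e x
       map_add' := fun _ _ => rfl
       map_smul' := fun _ _ => rfl
       cont := continuous_dualC_apply x } : DualC V →L[ℂ] ℂ)
  map_add' x y := by ext e; exact map_add e x y
  map_smul' c x := by ext e; exact map_smul e c x

lemma evalEps_apply (x : V) (e : DualC V) : evalEps x e = e x := rfl

lemma surjective_evalEps : Function.Surjective (evalEps : V → EpsProd V ℂ) := fun F => by
  obtain ⟨x, hx⟩ := exists_eval_of_continuous (V := V) F
  refine ⟨x, ?_⟩
  ext e
  exact (hx e).symm

lemma isInducing_evalEps [LocallyConvexSpace ℝ V] :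
    IsInducing (evalEps : V → EpsProd V ℂ) := by
  refine (IsTopologicalAddGroup.isInducing_iff_nhds_zero
    (f := (evalEps : V →ₗ[ℂ] EpsProd V ℂ))).2 (le_antisymm ?_ ?_)
  · rw [← tendsto_iff_comap, UniformConvergenceCLM.nhds_zero_eq]
    simp only [tendsto_iInf, tendsto_principal]
    intro A hA W hW
    obtain ⟨p, hp, hAp⟩ := exists_polarBall_superset hA
    obtain ⟨ε, hε, hεW⟩ := Metric.mem_nhds_iff.1 hW
    filter_upwards [eventually_seminorm_lt hp hε] with x hx e he
    refine hεW ?_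
    rw [mem_ball_zero_iff]
    exact (hAp he x).trans_lt hx
  · intro U hU
    obtain ⟨p, hp, hpU⟩ := exists_seminorm_of_mem_nhds hU
    refine ⟨_, UniformConvergenceCLM.eventually_nhds_zero_mapsTo (RingHom.id ℂ)
      (polarBall_mem_equicontinuousSets hp)
      (Metric.ball_mem_nhds (0 : ℂ) (one_half_pos (α := ℝ))), fun x hx => hpU x ?_⟩
    refine (seminorm_le_of_forall_dual hp (r := 1 / 2) fun e he => ?_).trans_lt (by norm_num)
    exact (mem_ball_zero_iff.1 (hx he)).le

/-- If `V` has the convex compactness property, then the transposes of the operators in a compact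
subset of `L_ε(V'_c, L)` map each equicontinuous set into one common absolutely convex compact set.
-/
lemma exists_absConvexCompact_transpose [LocallyConvexSpace ℝ V] (hcc : ConvexCompactness V)
    {H : Set (EpsProd V L)} (hH : IsCompact H) {p : Seminorm ℂ L} (hp : Continuous p) :
    ∃ P ∈ absConvexCompacts V, ∀ h ∈ H, ∀ l ∈ polarBall p, ∃ x ∈ P, ∀ e, l (h e) = e x := by
  have hc := continuousOn_comp_polarBall (F := DualC V) (L := L) (equicontinuousSets V)
    (fun A hA h => by
      obtain ⟨q, hq, hAq⟩ := exists_polarBall_superset hA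
      refine ⟨_, absConvexCompacts_image (h : DualC V →L[ℂ] L)
        ⟨balanced_polarBall q, convex_polarBall q, isCompact_polarBall hq⟩, image_mono hAq⟩) hp
  have hcomp := (hH.prod (isCompact_polarBall hp)).image_of_continuousOn
    (hc.mono (prod_mono (subset_univ _) subset_rfl))
  obtain ⟨P, hP, hsub⟩ := hcc _ ((isInducing_evalEps (V := V)).isCompact_preimage' hcomp
    (fun F _ => surjective_evalEps F))
  refine ⟨P, hP, fun h hh l hl => ?_⟩
  obtain ⟨x, hx⟩ := surjective_evalEps (dualComp h l)
  refine ⟨x, hsub ?_, fun e => ?_⟩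
  · rw [mem_preimage, hx]
    exact mem_image_of_mem (fun q : EpsProd V L × DualC L => dualComp q.1 q.2) (mk_mem_prod hh hl)
  · rw [← evalEps_apply x, hx, dualComp_apply]

end Transpose

/-! ### Bounded maps and subspaces of `𝒟'(ℝⁿ; V)` -/

section Bounded

variable {V : Type*} [AddCommGroup V] [Module ℂ V] [TopologicalSpace V] [IsTopologicalAddGroup V]
  [ContinuousSMul ℂ V] [LocallyConvexSpace ℝ V]

lemma isVonNBounded_iff_seminorm {s : Set V} :
    IsVonNBounded ℂ s ↔ ∀ p : Seminorm ℂ V, Continuous p → ∃ r : ℝ, ∀ x ∈ s, p x ≤ r := by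
  have := polynormableSpace_complex V
  rw [(PolynormableSpace.withSeminorms ℂ V).isVonNBounded_iff_seminorm_bounded]
  constructor
  · intro h p hp
    obtain ⟨r, -, hr⟩ := h ⟨p, hp⟩
    exact ⟨r, fun x hx => (hr x hx).le⟩
  · rintro h ⟨p, hp⟩
    obtain ⟨r, hr⟩ := h p hp
    exact ⟨max r 0 + 1, by positivity, fun x hx =>
      (hr x hx).trans_lt ((le_max_left r 0).trans_lt (lt_add_one _))⟩

/-- As `V` is the dual of `V'_c`, linear maps into the dual of `V'_c` are linear maps into `V`. -/
lemma exists_linear_transpose [T1Space V] {X : Type*} [AddCommGroup X] [Module ℂ X]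
    (w : X →ₗ[ℂ] EpsProd V ℂ) : ∃ S : X →ₗ[ℂ] V, ∀ x e, w x e = e (S x) := by
  have hinj : Function.Injective (evalEps : V →ₗ[ℂ] EpsProd V ℂ) := fun x y h =>
    eq_of_forall_dual fun e => by rw [← evalEps_apply x, h, evalEps_apply]
  let ev := LinearEquiv.ofBijective (evalEps : V →ₗ[ℂ] EpsProd V ℂ) ⟨hinj, surjective_evalEps⟩
  refine ⟨ev.symm.toLinearMap ∘ₗ w, fun x e => ?_⟩
  have : ev (ev.symm (w x)) = w x := ev.apply_symm_apply _
  rw [← this]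
  rfl

/-- A continuous linear map `u : V'_c → X'_b` is the transpose of a continuous linear map `X → V`,
if bounded linear maps on `X` are continuous. -/
lemma exists_transpose [T1Space V] {X : Type*} [AddCommGroup X] [Module ℂ X] [TopologicalSpace X]
    [IsTopologicalAddGroup X] [ContinuousSMul ℂ X]
    (hX : ∀ f : X →ₗ[ℂ] V, (∀ B, IsVonNBounded ℂ B → IsVonNBounded ℂ (f '' B)) → Continuous f)
    (u : DualC V →L[ℂ] (X →L[ℂ] ℂ)) : ∃ S : X →L[ℂ] V, ∀ e x, u e x = e (S x) := by
  let w : X →ₗ[ℂ] EpsProd V ℂ :=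
    { toFun := fun x => (
        { toFun := fun e => u e x
          map_add' := fun e f => by rw [map_add, add_apply]
          map_smul' := fun c e => by rw [map_smul, smul_apply, RingHom.id_apply]
          cont := (continuous_eval_const x).comp u.continuous } : DualC V →L[ℂ] ℂ)
      map_add' := fun x y => by ext e; exact map_add (u e) x y
      map_smul' := fun c x => by ext e; exact map_smul (u e) c x }
  obtain ⟨S, hS⟩ := exists_linear_transpose w
  refine ⟨⟨S, hX S fun B hB => isVonNBounded_iff_seminorm.2 fun p hp => ?_⟩, fun e x => hS x e⟩
  have h1 : IsVonNBounded ℂ (u '' polarBall p) :=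
    ((isVonNBounded_of_isCompact (isCompact_polarBall hp))).image u
  have h2 := ContinuousLinearMap.isVonNBounded_image2_apply h1 hB
  rw [NormedSpace.isVonNBounded_iff, isBounded_iff_forall_norm_le] at h2
  obtain ⟨r, hr⟩ := h2
  refine ⟨r, ?_⟩
  rintro _ ⟨x, hx, rfl⟩
  refine seminorm_le_of_forall_dual hp fun e he => ?_
  rw [← hS]
  exact hr _ (mem_image2_of_mem (mem_image_of_mem u he) hx)

/-- `𝒟(ℝⁿ)` is bornological. -/
lemma continuous_of_bounded_test {n : ℕ} (f : Test n →ₗ[ℂ] V)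
    (hf : ∀ B, IsVonNBounded ℂ B → IsVonNBounded ℂ (f '' B)) : Continuous f := by
  have := continuousSMul_real V
  rw [TestFunction.continuous_iff_continuous_comp]
  intro K hK
  have := (ContDiffMapSupportedIn.withSeminorms ℂ (Rn n) ℂ ⊤ K).firstCountableTopology
  refine LinearMap.continuous_of_locally_bounded (𝕜 := ℂ) (𝕜' := ℂ)
    (f ∘ₗ (TestFunction.ofSupportedInCLM ℂ hK).toLinearMap) fun B hB => ?_
  rw [LinearMap.coe_comp, image_comp]
  exact hf _ (hB.image (TestFunction.ofSupportedInCLM ℂ hK))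

end Bounded

section Spaces

variable {n : ℕ} {V : Type*} [AddCommGroup V] [Module ℂ V] [TopologicalSpace V]
  [IsTopologicalAddGroup V] [ContinuousSMul ℂ V]

/-- The inclusion map between two subspaces of `𝒟'(ℝⁿ; V)`. -/
def TopSubspace.inclusion {X Y : TopSubspace n V} (h : X.carrier ≤ Y.carrier) :
    X.Elem →ₗ[ℂ] Y.Elem := Submodule.inclusion h

lemma TopSubspace.eq_of_continuous_inclusion {X Y : TopSubspace n V}
    (h₁ : X.carrier ≤ Y.carrier) (h₂ : Y.carrier ≤ X.carrier)
    (hc₁ : Continuous (TopSubspace.inclusion h₁)) (hc₂ : Continuous (TopSubspace.inclusion h₂)) :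
    X = Y := by
  obtain ⟨X, t⟩ := X
  obtain ⟨Y, s⟩ := Y
  obtain rfl : X = Y := le_antisymm h₁ h₂
  congr 1
  exact le_antisymm (continuous_id_iff_le.1 hc₁) (continuous_id_iff_le.1 hc₂)

lemma TopSubspace.incl_injective (X : TopSubspace n V) : Function.Injective X.incl :=
  Submodule.subtype_injective X.carrier

/-- Evaluation at test functions is weakly continuous on `H`; this is all that is needed for the
uniqueness of the operator `[S]`. -/
def TopSubspace.WeaklyContinuousEval (H : TopSubspace n V) : Prop :=
  ∀ (e : DualC V) (ψ : Test n), Continuous fun x : H.Elem => e (H.incl x ψ)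

/-- The test functions are contained in `K` as a dense subset. -/
structure TopSubspace.HasDenseTest (K : TopSubspace n ℂ) : Prop where
  mem : ∀ φ : Test n, testToDist n φ ∈ K.carrier
  dense : DenseRange fun φ : Test n => K.elem (testToDist n φ) (mem φ)

lemma LCSubspace.IsNormal.hasDenseTest {H : LCSubspace n ℂ} (h : H.IsNormal) :
    H.toTopSubspace.HasDenseTest := ⟨h.testToDist_mem, h.dense_test⟩

lemma LCSubspace.IsNormal.weaklyContinuousEval {H : LCSubspace n ℂ} (h : H.IsNormal) :
    H.WeaklyContinuousEval := fun e ψ =>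
  (map_continuous e).comp ((continuous_eval_const ψ).comp h.continuous_incl)

lemma LCSubspace.IsNormal.t2Space {H : LCSubspace n ℂ} (h : H.IsNormal) : T2Space H.Elem :=
  T2Space.of_injective_continuous H.incl_injective h.continuous_incl

/-! ### `𝓗(V)` -/

variable (H : LCSubspace n ℂ) (V) in
/-- The isomorphism of `𝓗(V)` onto a subspace of `𝓗 ε V`. -/
def vecMap : (H.vec V).Elem →ₗ[ℂ] EpsProd V H.Elem := vecToEps H V

variable {H : LCSubspace n ℂ}

lemma isInducing_vecMap : IsInducing (vecMap V H) := ⟨rfl⟩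

lemma incl_vecMap (S : (H.vec V).Elem) (e : DualC V) (φ : Test n) :
    H.incl (vecMap V H S e) φ = e ((H.vec V).incl S φ) := vecToEps_apply H V S e φ

lemma vecMap_eq {S : (H.vec V).Elem} {u : EpsProd V H.Elem}
    (h : ∀ (e : DualC V) (φ : Test n), H.incl (u e) φ = e ((H.vec V).incl S φ)) :
    vecMap V H S = u :=
  eps_unique H V (S := (H.vec V).incl S) (incl_vecMap S) h

lemma vecMap_injective [LocallyConvexSpace ℝ V] [T1Space V] :
    Function.Injective (vecMap V H) := fun S T h => by
  refine (H.vec V).incl_injective ?_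
  ext φ
  refine eq_of_forall_dual fun e => ?_
  rw [← incl_vecMap, h, incl_vecMap]

lemma continuous_eps_apply (e : DualC V) : Continuous fun u : EpsProd V H.Elem => u e :=
  have := UniformConvergenceCLM.continuousEvalConst (RingHom.id ℂ) (E := DualC V) H.Elem
    (equicontinuousSets V) (eq_univ_of_forall fun e =>
      ⟨{e}, ⟨{x | ‖e x‖ < 1}, (map_continuous e).norm.continuousAt.eventually_lt continuousAt_const
        (by simp), fun f hf x hx => by rw [mem_singleton_iff.1 hf]; exact le_of_lt hx⟩, rfl⟩)
  continuous_eval_const e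

lemma weaklyContinuousEval_vec (hH : H.WeaklyContinuousEval) :
    (H.vec V).WeaklyContinuousEval := fun e ψ => by
  simp_rw [← incl_vecMap]
  exact (hH (ContinuousLinearMap.id ℂ ℂ) ψ).comp
    ((continuous_eps_apply e).comp isInducing_vecMap.continuous)

/-- If `H` is continuously contained in `𝒟'`, then `𝓗(V)` is all of `𝓗 ε V`. -/
lemma vecMap_surjective [LocallyConvexSpace ℝ V] [T1Space V] (hH : Continuous H.incl) :
    Function.Surjective (vecMap V H) := fun u => by
  obtain ⟨S, hS⟩ := exists_transpose (V := V) (X := Test n) continuous_of_bounded_test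
    ((⟨H.incl, hH⟩ : H.Elem →L[ℂ] Dist n ℂ).comp u)
  exact ⟨(H.vec V).elem S ⟨u, hS⟩, vecMap_eq hS⟩

/-- For `H` continuously contained in `𝒟'`, the space `𝓗(V)` is isomorphic to `𝓗 ε V`. -/
def vecEquiv [LocallyConvexSpace ℝ V] [T1Space V] (hH : Continuous H.incl) :
    (H.vec V).Elem ≃L[ℂ] EpsProd V H.Elem :=
  let f := LinearEquiv.ofBijective (vecMap V H) ⟨vecMap_injective, vecMap_surjective hH⟩
  { f with
    continuous_toFun := isInducing_vecMap.continuous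
    continuous_invFun := isInducing_vecMap.continuous_iff.2
      (continuous_id.congr fun u => (f.apply_symm_apply u).symm) }

lemma vecMap_vecEquiv_symm [LocallyConvexSpace ℝ V] [T1Space V] (hH : Continuous H.incl)
    (u : EpsProd V H.Elem) : vecMap V H ((vecEquiv hH).symm u) = u :=
  (vecEquiv (V := V) hH).apply_symm_apply u

/-! ### `𝓞_M(𝓚, 𝓛)` -/

variable {K : LCSubspace n ℂ} {L : LCSubspace n V}

lemma extendsMul_unique [LocallyConvexSpace ℝ V] [T1Space V] (hK : K.HasDenseTest)
    (hL : L.WeaklyContinuousEval) {S : Dist n V} {T T' : LinC K.Elem L.Elem}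
    (hT : ExtendsMul K L S T) (hT' : ExtendsMul K L S T') : T = T' := by
  ext k
  refine L.incl_injective ?_
  ext ψ
  refine eq_of_forall_dual fun e => ?_
  have := Continuous.ext_on hK.dense ((hL e ψ).comp (map_continuous T))
    ((hL e ψ).comp (map_continuous T')) (by
      rintro _ ⟨φ, rfl⟩
      change e (L.incl (T _) ψ) = e (L.incl (T' _) ψ)
      rw [hT φ (hK.mem φ), hT' φ (hK.mem φ)])
  exact congrFun this k

/-- The map `S ↦ [S]` as a linear map. -/
def opMap [LocallyConvexSpace ℝ V] [T1Space V] (hK : K.HasDenseTest)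
    (hL : L.WeaklyContinuousEval) : (OM K L).Elem →ₗ[ℂ] LinC K.Elem L.Elem where
  toFun := mulOperator K L
  map_add' S T := by
    refine extendsMul_unique hK hL (Classical.choose_spec (S + T).2) fun φ h ψ => ?_
    rw [add_apply, map_add, add_apply]
    exact congrArg₂ (· + ·) (Classical.choose_spec S.2 φ h ψ) (Classical.choose_spec T.2 φ h ψ)
  map_smul' c S := by
    refine extendsMul_unique hK hL (Classical.choose_spec (c • S).2) fun φ h ψ => ?_
    rw [smul_apply, map_smul, smul_apply]
    exact congrArg (c • ·) (Classical.choose_spec S.2 φ h ψ)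

variable [LocallyConvexSpace ℝ V] [T1Space V] (hK : K.HasDenseTest) (hL : L.WeaklyContinuousEval)

lemma isInducing_opMap : IsInducing (opMap hK hL) := ⟨rfl⟩

lemma extendsMul_opMap (S : (OM K L).Elem) : ExtendsMul K L ((OM K L).incl S) (opMap hK hL S) :=
  Classical.choose_spec (p := ExtendsMul K L ((OM K L).incl S)) S.2

lemma opMap_eq {S : (OM K L).Elem} {T : LinC K.Elem L.Elem}
    (hT : ExtendsMul K L ((OM K L).incl S) T) : opMap hK hL S = T :=
  extendsMul_unique hK hL (extendsMul_opMap hK hL S) hT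

include hK hL in
lemma isTopologicalAddGroup_OM : IsTopologicalAddGroup (OM K L).Elem :=
  topologicalAddGroup_induced (opMap hK hL)

end Spaces

/-! ### The identity `𝓞_M(𝓚, 𝓛)(V) = 𝓞_M(𝓚, 𝓛(V))` -/

section UniformConvergence

variable {X M F G : Type*} [AddCommGroup M] [Module ℂ M] [TopologicalSpace M]
  [AddCommGroup X] [Module ℂ X] [TopologicalSpace X] [IsTopologicalAddGroup X]
  [AddCommGroup F] [Module ℂ F] [TopologicalSpace F]
  [AddCommGroup G] [Module ℂ G] [TopologicalSpace G] [IsTopologicalAddGroup G] [ContinuousSMul ℂ G]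
  {𝔖 : Set (Set F)} {θ : M →ₗ[ℂ] UniformConvergenceCLM (RingHom.id ℂ) G 𝔖}

/-! For a space `M` with the topology induced by a linear map `θ` into a space of operators, the
following lemmas express neighbourhoods of `0`, boundedness and continuity by the values `θ x a`. -/

lemma eventually_of_isInducing (hθ : IsInducing θ) {A : Set F} (hA : A ∈ 𝔖) {U : Set G}
    (hU : U ∈ 𝓝 0) : ∀ᶠ x in 𝓝 (0 : M), ∀ a ∈ A, θ x a ∈ U :=
  (hθ.continuous.tendsto' 0 0 (map_zero θ)).eventually
    (UniformConvergenceCLM.eventually_nhds_zero_mapsTo _ hA hU)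

lemma mem_nhds_of_isInducing (hθ : IsInducing θ) (h₁ : 𝔖.Nonempty) (h₂ : DirectedOn (· ⊆ ·) 𝔖)
    {W : Set M} (hW : W ∈ 𝓝 0) :
    ∃ A ∈ 𝔖, ∃ U ∈ 𝓝 (0 : G), ∀ x, (∀ a ∈ A, θ x a ∈ U) → x ∈ W := by
  rw [hθ.nhds_eq_comap, map_zero] at hW
  obtain ⟨⟨A, U⟩, ⟨hA, hU⟩, h⟩ :=
    ((UniformConvergenceCLM.hasBasis_nhds_zero (RingHom.id ℂ) G 𝔖 h₁ h₂).comap θ).mem_iff.1 hW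
  exact ⟨A, hA, U, hU, fun x hx => h hx⟩

lemma isVonNBounded_of_isInducing (hθ : IsInducing θ) (h₁ : 𝔖.Nonempty)
    (h₂ : DirectedOn (· ⊆ ·) 𝔖) {s : Set M}
    (h : ∀ A ∈ 𝔖, IsVonNBounded ℂ (image2 (fun x a => θ x a) s A)) : IsVonNBounded ℂ s := by
  intro W hW
  obtain ⟨A, hA, U, hU, hAU⟩ := mem_nhds_of_isInducing hθ h₁ h₂ hW
  filter_upwards [h A hA hU, eventually_ne_cobounded 0] with c hc hc₀ x hx
  rw [mem_smul_set_iff_inv_smul_mem₀ hc₀]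
  refine hAU _ fun a ha => ?_
  rw [map_smul, smul_apply, ← mem_smul_set_iff_inv_smul_mem₀ hc₀]
  exact hc (mem_image2_of_mem hx ha)

lemma continuous_of_isInducing (hθ : IsInducing θ) {f : X →ₗ[ℂ] M}
    (h : ∀ A ∈ 𝔖, ∀ U ∈ 𝓝 (0 : G), ∀ᶠ x in 𝓝 (0 : X), ∀ a ∈ A, θ (f x) a ∈ U) :
    Continuous f := by
  rw [hθ.continuous_iff]
  refine continuous_of_tendsto_nhds_zero (θ ∘ₗ f) ?_
  rw [UniformConvergenceCLM.nhds_zero_eq]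
  simp only [tendsto_iInf, tendsto_principal]
  exact h

end UniformConvergence

section VecMultipliers

variable {n : ℕ} {V : Type*} [AddCommGroup V] [Module ℂ V] [TopologicalSpace V]
  [IsTopologicalAddGroup V] [ContinuousSMul ℂ V] [LocallyConvexSpace ℝ V] [T1Space V]
  {K L M : LCSubspace n ℂ}

/-- If `𝓚` carries the topology `γ` and `𝓚'_c` has the convex compactness property, then an element
`S` of `𝓜(V)`, where `𝓜 = 𝓞_M(𝓚, 𝓛)`, acts as a multiplication operator `𝓚 → 𝓛(V)`, namely by
`k ↦ (e' ↦ [⟨S, e'⟩] k)`. -/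
lemma exists_operator_of_vec (hL : Continuous L.incl)
    (hγ : HasTopologyGamma K.Elem) (hcc : ConvexCompactness (DualC K.Elem))
    {θ : M.Elem →ₗ[ℂ] LinC K.Elem L.Elem} (hθ : IsInducing θ)
    (hθM : ∀ x, ExtendsMul K L (M.incl x) (θ x)) (S : (M.vec V).Elem) :
    ∃ T : LinC K.Elem (L.vec V).Elem, ExtendsMul K (L.vec V) ((M.vec V).incl S) T ∧
      ∀ k e, vecMap V L (T k) e = θ (vecMap V M S e) k := by
  let Θ : M.Elem →L[ℂ] LinC K.Elem L.Elem := ⟨θ, hθ.continuous⟩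
  have hev : ∀ k : K.Elem, Continuous fun T : LinC K.Elem L.Elem => T k := fun k =>
    have := UniformConvergenceCLM.continuousEvalConst (RingHom.id ℂ) L.Elem
      (absConvexCompacts K.Elem) sUnion_absConvexCompacts
    continuous_eval_const k
  let w : K.Elem →ₗ[ℂ] EpsProd V L.Elem :=
    { toFun := fun k => (
        { toFun := fun e => Θ (vecMap V M S e) k
          map_add' := fun e f => by rw [map_add, map_add, add_apply]
          map_smul' := fun c e => by rw [map_smul, map_smul, smul_apply, RingHom.id_apply]
          cont := (hev k).comp (Θ.continuous.comp (map_continuous (vecMap V M S))) } :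
            DualC V →L[ℂ] L.Elem)
      map_add' := fun k l => by ext e; exact map_add (Θ (vecMap V M S e)) k l
      map_smul' := fun c k => by ext e; exact map_smul (Θ (vecMap V M S e)) c k }
  have hw : Continuous w := by
    refine continuous_of_isInducing (θ := LinearMap.id) IsInducing.id fun A hA U hU => ?_
    obtain ⟨p, hp, hAp⟩ := exists_polarBall_superset hA
    obtain ⟨q, hq, hqU⟩ := exists_seminorm_of_mem_nhds hU
    have hq2 : Continuous ((2 : NNReal) • q) := hq.const_smul (2 : NNReal)
    have hcomp : IsCompact ((fun e => Θ (vecMap V M S e)) '' polarBall p) :=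
      (isCompact_polarBall hp).image (Θ.continuous.comp (map_continuous (vecMap V M S)))
    -- The factor `2` yields a strict inequality for `q`.
    filter_upwards [equicontinuous_of_isCompact hγ hcc hcomp hq2] with k hk e he
    refine hqU _ ?_
    have : 2 * q (Θ (vecMap V M S e) k) ≤ 1 := hk _ (mem_image_of_mem _ (hAp he))
    change q (Θ (vecMap V M S e) k) < 1
    linarith
  let T : K.Elem →L[ℂ] (L.vec V).Elem :=
    (vecEquiv (V := V) hL).symm.toContinuousLinearMap.comp ⟨w, hw⟩
  have hT : ∀ k e, vecMap V L (T k) e = θ (vecMap V M S e) k := fun k e => by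
    have : vecMap V L (T k) = w k := vecMap_vecEquiv_symm hL (w k)
    rw [this]
    rfl
  refine ⟨T, fun φ h ψ => eq_of_forall_dual fun e => ?_, hT⟩
  rw [← incl_vecMap]
  refine (congrArg (fun z => L.incl z ψ) (hT _ e)).trans ?_
  rw [hθM _ φ h ψ, incl_vecMap]

/-- If `V` has the convex compactness property, then an `S ∈ 𝒟'(V)` that acts as a multiplication
operator `𝓚 → 𝓛(V)` belongs to `𝓜(V)`, where `𝓜 = 𝓞_M(𝓚, 𝓛)`. -/
lemma mem_vec_of_operator (hcc : ConvexCompactness V) (hK : K.HasDenseTest)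
    (hL : L.WeaklyContinuousEval)
    {θ : M.Elem →ₗ[ℂ] LinC K.Elem L.Elem} (hθ : IsInducing θ)
    (hθM : ∀ x, ExtendsMul K L (M.incl x) (θ x))
    (hM : ∀ (S : Dist n ℂ) (T : LinC K.Elem L.Elem), ExtendsMul K L S T → S ∈ M.carrier)
    {S : Dist n V} {T : LinC K.Elem (L.vec V).Elem} (hT : ExtendsMul K (L.vec V) S T) :
    S ∈ (M.vec V).carrier := by
  let Te : DualC V → LinC K.Elem L.Elem := fun e => (
    { toFun := fun k => vecMap V L (T k) e
      map_add' := fun k l => by rw [map_add, map_add, add_apply]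
      map_smul' := fun c k => by rw [map_smul, map_smul, smul_apply, RingHom.id_apply]
      cont := (continuous_eps_apply e).comp
        (isInducing_vecMap.continuous.comp (map_continuous T)) } : K.Elem →L[ℂ] L.Elem)
  have hTe : ∀ e : DualC V, ExtendsMul K L ((e : V →L[ℂ] ℂ).comp S) (Te e) := fun e φ h ψ => by
    change L.incl (vecMap V L (T _) e) ψ = e (S _)
    rw [incl_vecMap, hT φ h ψ]
  let u : DualC V →ₗ[ℂ] M.Elem :=
    { toFun := fun e => M.elem ((e : V →L[ℂ] ℂ).comp S) (hM _ _ (hTe e))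
      map_add' := fun e f => rfl
      map_smul' := fun c e => rfl }
  have hθu : ∀ e, θ (u e) = Te e := fun e => extendsMul_unique hK hL (hθM (u e)) (hTe e)
  have hu : Continuous u := by
    refine continuous_of_isInducing hθ fun C hC U hU => ?_
    obtain ⟨p, hp, hpU⟩ := exists_seminorm_of_mem_nhds hU
    have hcomp : IsCompact ((fun k => vecMap V L (T k)) '' C) :=
      hC.2.2.image (isInducing_vecMap.continuous.comp (map_continuous T))
    obtain ⟨P, hP, hPT⟩ := exists_absConvexCompact_transpose hcc hcomp hp
    filter_upwards [UniformConvergenceCLM.eventually_nhds_zero_mapsTo (RingHom.id ℂ) hP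
      (Metric.ball_mem_nhds (0 : ℂ) (one_half_pos (α := ℝ)))] with e he k hk
    refine hpU _ ?_
    rw [hθu]
    refine (seminorm_le_of_forall_dual hp (r := 1 / 2) fun l hl => ?_).trans_lt (by norm_num)
    obtain ⟨x, hx, hxl⟩ := hPT _ (mem_image_of_mem _ hk) l hl
    have : l (Te e k) = e x := hxl e
    rw [this]
    exact (mem_ball_zero_iff.1 (he hx)).le
  exact ⟨(⟨u, hu⟩ : DualC V →L[ℂ] M.Elem), fun e φ => rfl⟩

/-- `𝓜(V) = 𝓞_M(𝓚, 𝓛(V))` if `𝓜 = 𝓞_M(𝓚, 𝓛)`. -/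
theorem vec_eq_OM_vec (hK : K.IsNormal) (hL : L.IsNormal)
    (hγ : HasTopologyGamma K.Elem) (hcc : ConvexCompactness (DualC K.Elem))
    (hV : ConvexCompactness V) (hM : M.toTopSubspace = OM K L) :
    (M.vec V).toTopSubspace = OM K (L.vec V) := by
  obtain ⟨θ, hθ, hθM, hM⟩ : ∃ θ : M.Elem →ₗ[ℂ] LinC K.Elem L.Elem, IsInducing θ ∧
      (∀ x, ExtendsMul K L (M.incl x) (θ x)) ∧
      ∀ (S : Dist n ℂ) (T : LinC K.Elem L.Elem), ExtendsMul K L S T → S ∈ M.carrier := by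
    obtain ⟨M, h1, h2, h3⟩ := M
    dsimp only at hM
    subst hM
    exact ⟨opMap hK.hasDenseTest hL.weaklyContinuousEval, isInducing_opMap _ _,
      extendsMul_opMap _ _, fun S T h => ⟨T, h⟩⟩
  have hLV : (L.vec V).WeaklyContinuousEval := weaklyContinuousEval_vec hL.weaklyContinuousEval
  have h₁ : (M.vec V).carrier ≤ (OM K (L.vec V)).carrier := fun S hS => by
    obtain ⟨T, hT, -⟩ := exists_operator_of_vec hL.continuous_incl hγ hcc hθ hθM
      ((M.vec V).elem S hS)
    exact ⟨T, hT⟩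
  have h₂ : (OM K (L.vec V)).carrier ≤ (M.vec V).carrier := fun S ⟨T, hT⟩ =>
    mem_vec_of_operator hV hK.hasDenseTest hL.weaklyContinuousEval hθ hθM hM hT
  have key : ∀ (S : (M.vec V).Elem) k e,
      vecMap V L (opMap hK.hasDenseTest hLV (TopSubspace.inclusion h₁ S) k) e =
        θ (vecMap V M S e) k := fun S k e => by
    obtain ⟨T, hT, hTS⟩ := exists_operator_of_vec hL.continuous_incl hγ hcc hθ hθM S
    rw [opMap_eq (S := TopSubspace.inclusion h₁ S) _ _ hT, hTS]
  have := isTopologicalAddGroup_OM hK.hasDenseTest hLV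
  refine TopSubspace.eq_of_continuous_inclusion h₁ h₂ ?_ ?_
  · refine continuous_of_isInducing (isInducing_opMap hK.hasDenseTest hLV) fun C hC W hW => ?_
    obtain ⟨A, hA, U, hU, hAU⟩ := mem_nhds_of_isInducing isInducing_vecMap
      equicontinuousSets_nonempty equicontinuousSets_directed hW
    filter_upwards [eventually_of_isInducing isInducing_vecMap hA
      (eventually_of_isInducing hθ hC hU)] with S hS k hk
    refine hAU _ fun e he => ?_
    rw [key]
    exact hS e he k hk
  · refine continuous_of_isInducing isInducing_vecMap fun A hA W hW => ?_
    obtain ⟨C, hC, U, hU, hCU⟩ := mem_nhds_of_isInducing hθ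
      absConvexCompacts_nonempty absConvexCompacts_directed hW
    filter_upwards [eventually_of_isInducing (isInducing_opMap hK.hasDenseTest hLV) hC
      (eventually_of_isInducing isInducing_vecMap hA hU)] with S hS e he
    refine hCU _ fun k hk => ?_
    rw [← key]
    exact hS k hk e he

end VecMultipliers

/-! ### The identity `X'(V) = 𝓞_M(X, Y'(V))` -/

section OfRange

variable {n : ℕ} {X : Type*} [AddCommGroup X] [Module ℂ X] [TopologicalSpace X]
  [IsTopologicalAddGroup X] [ContinuousSMul ℂ X]

/-- For an injective map `ι`, the space `LCSubspace.ofRange ι` is isomorphic to `X`. -/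
def ofRangeEquiv [LocallyConvexSpace ℝ X] {ι : X →ₗ[ℂ] Dist n ℂ} (hι : Function.Injective ι) :
    X ≃L[ℂ] (LCSubspace.ofRange ι).Elem :=
  let f : X ≃ₗ[ℂ] (LCSubspace.ofRange ι).Elem := LinearEquiv.ofInjective ι hι
  have hf : IsOpenQuotientMap f := isOpenQuotientMap_rangeRestrict ι
  { f with
    continuous_toFun := hf.continuous
    continuous_invFun := by
      refine hf.isQuotientMap.continuous_iff.2 ?_
      exact continuous_id.congr fun x => (f.symm_apply_apply x).symm }

/-- The isomorphism of `X'_b` with the corresponding space of distributions. -/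
def dualEquiv {j : Test n →L[ℂ] X} (hj : DenseRange j) :
    (X →L[ℂ] ℂ) ≃L[ℂ] (LCSubspace.strongDual j).Elem :=
  ofRangeEquiv fun u v h => by
    ext x
    exact congrFun (hj.equalizer u.continuous v.continuous
      (funext fun φ => DFunLike.congr_fun (h : u.comp j = v.comp j) φ)) x

lemma incl_dualEquiv {j : Test n →L[ℂ] X} (hj : DenseRange j) (u : X →L[ℂ] ℂ) (φ : Test n) :
    (LCSubspace.strongDual j).incl (dualEquiv hj u) φ = u (j φ) := rfl

/-- The inverse of `dualEquiv`, with the topology of `X'_b` written as a topology of uniform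
convergence. -/
def dualMap {j : Test n →L[ℂ] X} (hj : DenseRange j) :
    (LCSubspace.strongDual j).Elem →ₗ[ℂ]
      UniformConvergenceCLM (RingHom.id ℂ) (E := X) ℂ {B | IsVonNBounded ℂ B} :=
  (dualEquiv hj).symm.toLinearMap

lemma dualMap_dualEquiv {j : Test n →L[ℂ] X} (hj : DenseRange j) (u : X →L[ℂ] ℂ) :
    dualMap hj (dualEquiv hj u) = u := (dualEquiv hj).symm_apply_apply u

lemma isInducing_dualMap {j : Test n →L[ℂ] X} (hj : DenseRange j) : IsInducing (dualMap hj) :=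
  (dualEquiv hj).symm.toHomeomorph.isInducing

lemma dualMap_apply {j : Test n →L[ℂ] X} (hj : DenseRange j)
    (x : (LCSubspace.strongDual j).Elem) (φ : Test n) :
    dualMap hj x (j φ) = (LCSubspace.strongDual j).incl x φ := by
  obtain ⟨u, rfl⟩ := (dualEquiv hj).surjective x
  rw [dualMap_dualEquiv, incl_dualEquiv]
  rfl

lemma continuous_dualMap_apply {j : Test n →L[ℂ] X} (hj : DenseRange j) (x : X) :
    Continuous fun w : (LCSubspace.strongDual j).Elem => dualMap hj w x :=
  (continuous_eval_const (F := X →L[ℂ] ℂ) x).comp (dualEquiv hj).symm.continuous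

lemma vonNBounded_nonempty : {B : Set X | IsVonNBounded ℂ B}.Nonempty :=
  ⟨∅, isVonNBounded_empty ℂ X⟩

lemma vonNBounded_directed : DirectedOn (· ⊆ ·) {B : Set X | IsVonNBounded ℂ B} :=
  fun A hA B hB => ⟨A ∪ B, hA.union hB, subset_union_left, subset_union_right⟩

lemma weaklyContinuousEval_strongDual {j : Test n →L[ℂ] X} (hj : DenseRange j) :
    (LCSubspace.strongDual j).WeaklyContinuousEval := fun e ψ => by
  simp_rw [← dualMap_apply hj]
  exact (map_continuous e).comp (continuous_dualMap_apply hj (j ψ))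

variable {V : Type*} [AddCommGroup V] [Module ℂ V] [TopologicalSpace V]
  [IsTopologicalAddGroup V] [ContinuousSMul ℂ V]

/-- A continuous linear map `R : X → V` that maps bounded sets into absolutely convex compact sets
defines an element of `X'(V)`. -/
lemma mem_vec_strongDual {j : Test n →L[ℂ] X} (hj : DenseRange j) (R : X →L[ℂ] V)
    (hR : ∀ B, IsVonNBounded ℂ B → ∃ C ∈ absConvexCompacts V, R '' B ⊆ C) :
    R.comp j ∈ ((LCSubspace.strongDual j).vec V).carrier := by
  let u : DualC V →ₗ[ℂ] (LCSubspace.strongDual j).Elem :=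
    { toFun := fun e => dualEquiv hj ((e : V →L[ℂ] ℂ).comp R)
      map_add' := fun e f => rfl
      map_smul' := fun c e => rfl }
  have hu : Continuous u := by
    refine continuous_of_isInducing (isInducing_dualMap hj) fun B hB U hU => ?_
    obtain ⟨C, hC, hRC⟩ := hR B hB
    filter_upwards [UniformConvergenceCLM.eventually_nhds_zero_mapsTo (RingHom.id ℂ) hC hU]
      with e he x hx
    have : dualMap hj (u e) x = e (R x) := by
      change dualMap hj (dualEquiv hj _) x = _
      rw [dualMap_dualEquiv]
      rfl
    rw [this]
    exact he (hRC (mem_image_of_mem R hx))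
  exact ⟨(⟨u, hu⟩ : DualC V →L[ℂ] _), fun e φ => rfl⟩

lemma dualMap_vecMap {j : Test n →L[ℂ] X} (hj : DenseRange j) {R : X →L[ℂ] V}
    {S : ((LCSubspace.strongDual j).vec V).Elem}
    (hS : ∀ φ, ((LCSubspace.strongDual j).vec V).incl S φ = R (j φ)) (e : DualC V) (x : X) :
    dualMap hj (vecMap V _ S e) x = e (R x) := by
  refine congrFun (hj.equalizer (map_continuous (dualMap hj (vecMap V _ S e)))
    ((map_continuous e).comp R.continuous) (funext fun φ => ?_)) x
  simp only [Function.comp_apply]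
  rw [dualMap_apply, incl_vecMap, hS]

end OfRange

section Pair

universe u v w

variable {n : ℕ} {X : Type u} {Y : Type v} [AddCommGroup X] [Module ℂ X] [TopologicalSpace X]
  [IsTopologicalAddGroup X] [ContinuousSMul ℂ X] [LocallyConvexSpace ℝ X]
  [AddCommGroup Y] [Module ℂ Y] [TopologicalSpace Y]
  [IsTopologicalAddGroup Y] [ContinuousSMul ℂ Y]

/-- Function spaces `X` and `Y` that contain `𝒟` as a dense subspace, with a multiplication
`X × Y → X` that has the properties needed for the proof of `X'(V) = 𝓞_M(X, Y'(V))`: it is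
continuous in the second argument and maps products of bounded sets to bounded sets, the unit
element `one` of `Y` can be approximated by test functions that are equal to `1` on the support of a given
test function, and in `X` bounded sets are contained in absolutely convex compact sets. -/
structure IsMultiplierPair (jX : Test n →L[ℂ] X) (jY : Test n →L[ℂ] Y) (ι : X →ₗ[ℂ] Dist n ℂ)
    (mul : X →ₗ[ℂ] Y →ₗ[ℂ] X) (one : Y) : Prop where
  dense_left : DenseRange jX
  dense_right : DenseRange jY
  injective : Function.Injective ι
  incl_test : ∀ φ, ι (jX φ) = testToDist n φ
  mul_test : ∀ φ ψ, mul (jX φ) (jY ψ) = jX (testMul φ ψ)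
  mul_one : ∀ x, mul x one = x
  bounded_mul : ∀ A B, IsVonNBounded ℂ A → IsVonNBounded ℂ B →
    IsVonNBounded ℂ (image2 (fun x y => mul x y) A B)
  continuous_mul : ∀ x, Continuous (mul x)
  one_mem_closure : ∀ φ : Test n, one ∈ closure (jY '' {ψ | testMul φ ψ = φ})
  montel : ∀ B : Set X, IsVonNBounded ℂ B → ∃ C ∈ absConvexCompacts X, B ⊆ C

/-- Bounded linear maps from `X` to `W` are continuous. -/
def IsBornologicalInto (X : Type u) [AddCommGroup X] [Module ℂ X] [TopologicalSpace X]
    (W : Type w) [AddCommGroup W] [Module ℂ W] [TopologicalSpace W] : Prop :=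
  ∀ f : X →ₗ[ℂ] W, (∀ B, IsVonNBounded ℂ B → IsVonNBounded ℂ (f '' B)) → Continuous f

variable {jX : Test n →L[ℂ] X} {jY : Test n →L[ℂ] Y} {ι : X →ₗ[ℂ] Dist n ℂ}
  {mul : X →ₗ[ℂ] Y →ₗ[ℂ] X} {one : Y}

namespace IsMultiplierPair

variable (h : IsMultiplierPair jX jY ι mul one)
include h

lemma hasDenseTest : (LCSubspace.ofRange ι).HasDenseTest where
  mem φ := ⟨jX φ, h.incl_test φ⟩
  dense := by
    have := (ofRangeEquiv h.injective).surjective.denseRange.comp h.dense_left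
      (ofRangeEquiv h.injective).continuous
    refine this.mono ?_
    rintro _ ⟨φ, rfl⟩
    exact ⟨φ, Subtype.ext (h.incl_test φ).symm⟩

lemma elem_test (φ : Test n) (hφ : testToDist n φ ∈ (LCSubspace.ofRange ι).carrier) :
    (LCSubspace.ofRange ι).elem (testToDist n φ) hφ = ofRangeEquiv h.injective (jX φ) :=
  Subtype.ext (h.incl_test φ).symm

variable {V : Type w} [AddCommGroup V] [Module ℂ V] [TopologicalSpace V]
  [IsTopologicalAddGroup V] [ContinuousSMul ℂ V] [LocallyConvexSpace ℝ V] [T1Space V]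

/-- All continuous linear maps `X → V` belong to `X'(V)`, because `X` is a Montel space. -/
lemma comp_mem_vec (R : X →L[ℂ] V) : R.comp jX ∈ ((LCSubspace.strongDual jX).vec V).carrier :=
  mem_vec_strongDual h.dense_left R fun B hB =>
    let ⟨_, hC, hBC⟩ := h.montel B hB
    ⟨_, absConvexCompacts_image R hC, image_mono hBC⟩

/-- All elements of `X'(V)` are continuous linear maps `X → V`, because `X` is bornological. -/
lemma exists_extension_of_mem_vec (hb : IsBornologicalInto X V)
    (S : ((LCSubspace.strongDual jX).vec V).Elem) :
    ∃ R : X →L[ℂ] V, ((LCSubspace.strongDual jX).vec V).incl S = R.comp jX := by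
  obtain ⟨R, hR⟩ := exists_transpose hb
    (((dualEquiv h.dense_left).symm.toContinuousLinearMap).comp
      (vecMap V _ S : DualC V →L[ℂ] (LCSubspace.strongDual jX).Elem))
  refine ⟨R, ?_⟩
  ext φ
  refine eq_of_forall_dual fun e => ?_
  rw [← incl_vecMap, ← dualMap_apply h.dense_left]
  exact hR e (jX φ)

/-- A continuous linear map `R : X → V` defines the multiplication operator `x ↦ (y ↦ R (x y))` from
`X` to `Y'(V)`. -/
lemma exists_operator (hb : IsBornologicalInto X ((LCSubspace.strongDual jY).vec V).Elem)
    (R : X →L[ℂ] V) :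
    ∃ T : LinC (LCSubspace.ofRange ι).Elem ((LCSubspace.strongDual jY).vec V).Elem,
      ExtendsMul (LCSubspace.ofRange ι) ((LCSubspace.strongDual jY).vec V) (R.comp jX) T ∧
      ∀ x e y, dualMap h.dense_right (vecMap V _ (T (ofRangeEquiv h.injective x)) e) y =
        e (R (mul x y)) := by
  let Rm : X → (Y →L[ℂ] V) := fun x => R.comp ⟨mul x, h.continuous_mul x⟩
  have hmem : ∀ x, (Rm x).comp jY ∈ ((LCSubspace.strongDual jY).vec V).carrier := fun x => by
    refine mem_vec_strongDual h.dense_right _ fun B hB => ?_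
    obtain ⟨C, hC, hBC⟩ := h.montel _ (hB.image (⟨mul x, h.continuous_mul x⟩ : Y →L[ℂ] X))
    refine ⟨_, absConvexCompacts_image R hC, ?_⟩
    rintro _ ⟨y, hy, rfl⟩
    exact mem_image_of_mem R (hBC (mem_image_of_mem _ hy))
  let T₀ : X →ₗ[ℂ] ((LCSubspace.strongDual jY).vec V).Elem :=
    { toFun := fun x => ((LCSubspace.strongDual jY).vec V).elem _ (hmem x)
      map_add' := fun x y => Subtype.ext (by
        ext φ
        change R (mul (x + y) (jY φ)) = R (mul x (jY φ)) + R (mul y (jY φ))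
        rw [map_add, LinearMap.add_apply, map_add])
      map_smul' := fun c x => Subtype.ext (by
        ext φ
        change R (mul (c • x) (jY φ)) = c • R (mul x (jY φ))
        rw [map_smul, LinearMap.smul_apply, map_smul]) }
  have hT₀ : ∀ x e y, dualMap h.dense_right (vecMap V _ (T₀ x) e) y = e (R (mul x y)) :=
    fun x e y => dualMap_vecMap h.dense_right (R := Rm x) (fun φ => rfl) e y
  have hc : Continuous T₀ := by
    refine hb T₀ fun B hB => isVonNBounded_of_isInducing isInducing_vecMap
      equicontinuousSets_nonempty equicontinuousSets_directed fun A hA =>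
      isVonNBounded_of_isInducing (isInducing_dualMap h.dense_right) vonNBounded_nonempty
        vonNBounded_directed fun B' hB' => ?_
    obtain ⟨p, hp, hAp⟩ := exists_polarBall_superset hA
    obtain ⟨r, hr⟩ := isVonNBounded_iff_seminorm.1 ((h.bounded_mul B B' hB hB').image R) p hp
    rw [NormedSpace.isVonNBounded_iff, isBounded_iff_forall_norm_le]
    refine ⟨r, ?_⟩
    rintro _ ⟨_, ⟨_, ⟨x, hx, rfl⟩, e, he, rfl⟩, y, hy, rfl⟩
    change ‖dualMap h.dense_right (vecMap V _ (T₀ x) e) y‖ ≤ r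
    rw [hT₀]
    exact (hAp he _).trans (hr _ (mem_image_of_mem R (mem_image2_of_mem hx hy)))
  refine ⟨((⟨T₀, hc⟩ : X →L[ℂ] _).comp (ofRangeEquiv h.injective).symm.toContinuousLinearMap :
    _ →L[ℂ] _), fun φ hφ ψ => ?_, fun x e y => ?_⟩
  · rw [h.elem_test]
    change ((LCSubspace.strongDual jY).vec V).incl (T₀ ((ofRangeEquiv h.injective).symm _)) ψ = _
    rw [ContinuousLinearEquiv.symm_apply_apply]
    exact congrArg R (h.mul_test φ ψ)
  · change dualMap h.dense_right (vecMap V _ (T₀ ((ofRangeEquiv h.injective).symm _)) e) y = _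
    rw [ContinuousLinearEquiv.symm_apply_apply, hT₀]

/-- The extension of `S` to `X` is obtained by evaluating `[S] x ∈ Y'(V)` at the unit element. -/
lemma exists_extension_of_operator {S : Dist n V}
    {T : LinC (LCSubspace.ofRange ι).Elem ((LCSubspace.strongDual jY).vec V).Elem}
    (hT : ExtendsMul (LCSubspace.ofRange ι) ((LCSubspace.strongDual jY).vec V) S T) :
    ∃ R : X →L[ℂ] V, S = R.comp jX := by
  let g : X → DualC V → Y →L[ℂ] ℂ := fun x e =>
    dualMap h.dense_right (vecMap V _ (T (ofRangeEquiv h.injective x)) e)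
  let w : X →ₗ[ℂ] EpsProd V ℂ :=
    { toFun := fun x => (
        { toFun := fun e => g x e one
          map_add' := fun e f => by
            simp only [g, map_add]
            rfl
          map_smul' := fun c e => by
            simp only [g, map_smul]
            rfl
          cont := (continuous_dualMap_apply h.dense_right one).comp
            (map_continuous (vecMap V _ _)) } :
            DualC V →L[ℂ] ℂ)
      map_add' := fun x y => by
        ext e
        change g (x + y) e one = g x e one + g y e one
        simp only [g, map_add, add_apply]
        rfl
      map_smul' := fun c x => by
        ext e
        change g (c • x) e one = c • g x e one
        simp only [g, map_smul, smul_apply]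
        rfl }
  obtain ⟨R, hR⟩ := exists_linear_transpose w
  have hR' : ∀ x e, g x e one = e (R x) := hR
  have hc : Continuous R := by
    refine continuous_of_tendsto_nhds_zero R fun U hU => ?_
    obtain ⟨p, hp, hpU⟩ := exists_seminorm_of_mem_nhds hU
    have h1 : ∀ᶠ z in 𝓝 (0 : (LCSubspace.strongDual jY).Elem),
        dualMap h.dense_right z one ∈ Metric.ball (0 : ℂ) (1 / 2) :=
      ((continuous_dualMap_apply h.dense_right one).tendsto' 0 0
        (by rw [map_zero, zero_apply])).eventually (Metric.ball_mem_nhds 0 (by norm_num))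
    have h2 := eventually_of_isInducing (isInducing_vecMap (V := V)
      (H := LCSubspace.strongDual jY)) (polarBall_mem_equicontinuousSets hp) h1
    have h3 := ((T : _ →L[ℂ] _).continuous.comp (ofRangeEquiv h.injective).continuous).tendsto' 0 0
      (by rw [Function.comp_apply, map_zero]; exact map_zero T)
    rw [mem_map]
    filter_upwards [h3.eventually h2] with x hx
    refine hpU _ ((seminorm_le_of_forall_dual hp (r := 1 / 2) fun e he => ?_).trans_lt
      (by norm_num))
    rw [← hR']
    exact (mem_ball_zero_iff.1 (hx e he)).le
  refine ⟨⟨R, hc⟩, ?_⟩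
  ext φ
  refine eq_of_forall_dual fun e => ?_
  change e (S φ) = e (R (jX φ))
  rw [← hR']
  -- On the test functions that are `1` on the support of `φ`, the functional `g (jX φ) e` is
  -- constant.
  have hcl : IsClosed {y : Y | g (jX φ) e y = e (S φ)} :=
    isClosed_eq (g (jX φ) e).continuous continuous_const
  refine (hcl.closure_subset_iff.2 ?_ (h.one_mem_closure φ)).symm
  rintro _ ⟨ψ, hψ, rfl⟩
  change dualMap h.dense_right (vecMap V _ (T (ofRangeEquiv h.injective (jX φ))) e) (jY ψ) = _
  rw [dualMap_apply, incl_vecMap, ← h.elem_test φ (h.hasDenseTest.mem φ), hT, hψ]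

/-- `X'(V) = 𝓞_M(X, Y'(V))`. -/
theorem vec_strongDual_eq_OM (hb : IsBornologicalInto X V)
    (hb' : IsBornologicalInto X ((LCSubspace.strongDual jY).vec V).Elem) :
    ((LCSubspace.strongDual jX).vec V).toTopSubspace =
      OM (LCSubspace.ofRange ι) ((LCSubspace.strongDual jY).vec V) := by
  have hK := h.hasDenseTest
  have hL : ((LCSubspace.strongDual jY).vec V).WeaklyContinuousEval :=
    weaklyContinuousEval_vec (weaklyContinuousEval_strongDual h.dense_right)
  have h₁ : ((LCSubspace.strongDual jX).vec V).carrier ≤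
      (OM (LCSubspace.ofRange ι) ((LCSubspace.strongDual jY).vec V)).carrier := fun S hS => by
    obtain ⟨R, hR⟩ := h.exists_extension_of_mem_vec hb
      (((LCSubspace.strongDual jX).vec V).elem S hS)
    obtain ⟨T, hT, -⟩ := h.exists_operator hb' R
    obtain rfl : S = R.comp jX := hR
    exact ⟨T, hT⟩
  have h₂ : (OM (LCSubspace.ofRange ι) ((LCSubspace.strongDual jY).vec V)).carrier ≤
      ((LCSubspace.strongDual jX).vec V).carrier := fun S ⟨T, hT⟩ => by
    obtain ⟨R, rfl⟩ := h.exists_extension_of_operator hT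
    exact h.comp_mem_vec R
  have key : ∀ (S : ((LCSubspace.strongDual jX).vec V).Elem) x e y,
      dualMap h.dense_right (vecMap V _ (opMap hK hL (TopSubspace.inclusion h₁ S)
        (ofRangeEquiv h.injective x)) e) y = dualMap h.dense_left (vecMap V _ S e) (mul x y) := by
    intro S x e y
    obtain ⟨R, hR⟩ := h.exists_extension_of_mem_vec hb S
    obtain ⟨T, hT, hTR⟩ := h.exists_operator hb' R
    rw [← hR] at hT
    rw [opMap_eq (S := TopSubspace.inclusion h₁ S) hK hL hT, hTR,
      dualMap_vecMap h.dense_left (R := R) fun φ => DFunLike.congr_fun hR φ]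
  have := isTopologicalAddGroup_OM hK hL
  refine TopSubspace.eq_of_continuous_inclusion h₁ h₂ ?_ ?_
  · refine continuous_of_isInducing (isInducing_opMap hK hL) fun C hC W hW => ?_
    obtain ⟨A, hA, U, hU, hAU⟩ := mem_nhds_of_isInducing isInducing_vecMap
      equicontinuousSets_nonempty equicontinuousSets_directed hW
    obtain ⟨B, hB, Z, hZ, hBZ⟩ := mem_nhds_of_isInducing (isInducing_dualMap h.dense_right)
      vonNBounded_nonempty vonNBounded_directed hU
    have hC' : IsVonNBounded ℂ ((ofRangeEquiv h.injective).symm '' C) :=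
      (isVonNBounded_of_isCompact hC.2.2).image
        (ofRangeEquiv h.injective).symm.toContinuousLinearMap
    filter_upwards [eventually_of_isInducing isInducing_vecMap hA
      (eventually_of_isInducing (isInducing_dualMap h.dense_left)
        (h.bounded_mul _ _ hC' hB) hZ)] with S hS k hk
    refine hAU _ fun e he => hBZ _ fun y hy => ?_
    obtain ⟨x, rfl⟩ := (ofRangeEquiv h.injective).surjective k
    rw [key]
    refine hS e he _ (mem_image2_of_mem ⟨_, hk, ?_⟩ hy)
    rw [ContinuousLinearEquiv.symm_apply_apply]
  · refine continuous_of_isInducing isInducing_vecMap fun A hA W hW => ?_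
    obtain ⟨B, hB, Z, hZ, hBZ⟩ := mem_nhds_of_isInducing (isInducing_dualMap h.dense_left)
      vonNBounded_nonempty vonNBounded_directed hW
    obtain ⟨C, hC, hBC⟩ := h.montel B hB
    have hone : ∀ᶠ z in 𝓝 (0 : (LCSubspace.strongDual jY).Elem), dualMap h.dense_right z one ∈ Z :=
      ((continuous_dualMap_apply h.dense_right one).tendsto' 0 0
        (by rw [map_zero, zero_apply])).eventually hZ
    filter_upwards [eventually_of_isInducing (isInducing_opMap hK hL)
      (absConvexCompacts_image (ofRangeEquiv h.injective).toContinuousLinearMap hC)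
      (eventually_of_isInducing isInducing_vecMap hA hone)] with S hS e he
    refine hBZ _ fun x hx => ?_
    have := hS _ (mem_image_of_mem _ (hBC hx)) e he
    have hk := key (TopSubspace.inclusion h₂ S) x e one
    rw [h.mul_one] at hk
    rw [← hk]
    exact this

end IsMultiplierPair

end Pair

/-! ### Bounded and compact sets of test functions and of Schwartz functions -/

section UniformLimits

lemma tendstoLocallyUniformly_of_lipschitz {ι E G : Type*} [PseudoMetricSpace E]
    [LocallyCompactSpace E] [PseudoMetricSpace G] {l : Filter ι} {F : ι → E → G} {g : E → G} {C : NNReal}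
    (hF : ∀ i, LipschitzWith C (F i)) (h : ∀ x, Tendsto (fun i => F i x) l (𝓝 (g x))) :
    TendstoLocallyUniformly F g l := by
  rw [tendstoLocallyUniformly_iff_forall_isCompact]
  intro K hK
  have := (EquicontinuousOn.tendsto_uniformOnFun_iff_pi (𝔖 := {K : Set E | IsCompact K}) (F := F)
    (fun K hK => hK) (sUnion_eq_univ_iff.2 fun x => ⟨{x}, isCompact_singleton, rfl⟩)
    (fun K _ => ((LipschitzWith.uniformEquicontinuous F C hF).equicontinuous).equicontinuousOn K)
    l g).2 (tendsto_pi_nhds.2 h)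
  exact UniformOnFun.tendsto_iff_tendstoUniformlyOn.1 this K hK

instance (E F : Type*) [NormedAddCommGroup E] [NormedSpace ℝ E] [FiniteDimensional ℝ E]
    [NormedAddCommGroup F] [NormedSpace ℝ F] [FiniteDimensional ℝ F] (l : ℕ) :
    FiniteDimensional ℝ (E [×l]→L[ℝ] F) :=
  Module.Finite.of_injective
    (ContinuousMultilinearMap.toMultilinearMapLinear (R' := ℝ) (A := ℝ) (M₁ := fun _ : Fin l => E)
      (M₂ := F)) ContinuousMultilinearMap.toMultilinearMap_injective

end UniformLimits

section Schwartz

variable {n : ℕ}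

/-- The Schwartz functions whose seminorms are bounded by given constants. -/
def schwartzBall (M : ℕ → ℕ → ℝ) : Set 𝓢(Rn n, ℂ) :=
  {f | ∀ k l, SchwartzMap.seminorm ℂ k l f ≤ M k l}

lemma balanced_schwartzBall (M : ℕ → ℕ → ℝ) : Balanced ℂ (schwartzBall (n := n) M) := by
  rintro a ha _ ⟨f, hf, rfl⟩ k l
  change SchwartzMap.seminorm ℂ k l (a • f) ≤ M k l
  rw [map_smul_eq_mul]
  exact (mul_le_of_le_one_left (apply_nonneg _ _) ha).trans (hf k l)

lemma convex_schwartzBall (M : ℕ → ℕ → ℝ) : Convex ℝ (schwartzBall (n := n) M) := by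
  have : schwartzBall (n := n) M =
      ⋂ (k : ℕ) (l : ℕ), {f | SchwartzMap.seminorm ℝ k l f ≤ M k l} := by
    ext f
    simp only [schwartzBall, mem_iInter]
    rfl
  rw [this]
  refine convex_iInter fun k => convex_iInter fun l => ?_
  have := (SchwartzMap.seminorm ℝ k l : Seminorm ℝ 𝓢(Rn n, ℂ)).convexOn.convex_le (M k l)
  simpa using this

/-- Every ultrafilter on `schwartzBall M` converges in `𝒮` to an element of `schwartzBall M`: the
derivatives converge locally uniformly, and the decay is uniform. -/
lemma exists_limit_schwartzBall (M : ℕ → ℕ → ℝ) (𝒰 : Ultrafilter (schwartzBall (n := n) M)) :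
    ∃ g ∈ schwartzBall (n := n) M,
      Tendsto (fun f : schwartzBall (n := n) M => (f : 𝓢(Rn n, ℂ))) 𝒰 (𝓝 g) := by
  have hbd : ∀ k l x (f : schwartzBall (n := n) M), ‖x‖ ^ k * ‖iteratedFDeriv ℝ l f.1 x‖ ≤ M k l :=
    fun k l x f => (SchwartzMap.le_seminorm ℂ k l f.1 x).trans (f.2 k l)
  have hM : ∀ k l, 0 ≤ M k l := by
    obtain ⟨f⟩ : Nonempty (schwartzBall (n := n) M) := 𝒰.nonempty_of_mem univ_mem |>.to_type
    exact fun k l => (apply_nonneg _ _).trans (f.2 k l)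
  -- The derivatives converge pointwise because they are bounded.
  have hlim : ∀ x l, ∃ a, Tendsto (fun f : schwartzBall (n := n) M => iteratedFDeriv ℝ l f.1 x)
      𝒰 (𝓝 a) := by
    intro x l
    have := FiniteDimensional.proper ℝ ((Rn n) [×l]→L[ℝ] ℂ)
    obtain ⟨a, -, ha⟩ := (isCompact_closedBall (0 : (Rn n) [×l]→L[ℝ] ℂ) (M 0 l)).ultrafilter_le_nhds
      (𝒰.map fun f : schwartzBall (n := n) M => iteratedFDeriv ℝ l f.1 x) (by
        have h1 : ∀ᶠ f : schwartzBall (n := n) M in (𝒰 : Filter _),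
            iteratedFDeriv ℝ l f.1 x ∈ Metric.closedBall 0 (M 0 l) :=
          Eventually.of_forall fun f => by
            rw [mem_closedBall_zero_iff]
            simpa using hbd 0 l x f
        rw [le_principal_iff]
        exact h1)
    exact ⟨a, ha⟩
  choose G hG using hlim
  -- The bounds for the next derivatives make the convergence locally uniform.
  have hlip : ∀ l (f : schwartzBall (n := n) M),
      LipschitzWith (M 0 (l + 1)).toNNReal (iteratedFDeriv ℝ l f.1) := by
    intro l f
    refine lipschitzWith_of_nnnorm_fderiv_le (𝕜 := ℝ)
      ((f.1.smooth ⊤).differentiable_iteratedFDeriv (mod_cast ENat.natCast_lt_top l)) fun x => ?_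
    rw [← NNReal.coe_le_coe, coe_nnnorm, norm_fderiv_iteratedFDeriv, Real.coe_toNNReal _ (hM _ _)]
    simpa using hbd 0 (l + 1) x f
  have hunif : ∀ l, TendstoLocallyUniformly
      (fun (f : schwartzBall (n := n) M) x => iteratedFDeriv ℝ l f.1 x) (fun x => G x l) 𝒰 :=
    fun l => tendstoLocallyUniformly_of_lipschitz (hlip l) fun x => hG x l
  have hderiv : ∀ l x, HasFDerivAt (fun y => G y l) (G x (l + 1)).curryLeft x := by
    intro l x
    let e := continuousMultilinearCurryLeftEquiv ℝ (fun _ : Fin (l + 1) => Rn n) ℂ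
    have h1 : TendstoLocallyUniformlyOn (fun (f : schwartzBall (n := n) M) x =>
        e (iteratedFDeriv ℝ (l + 1) f.1 x)) (fun x => e (G x (l + 1))) 𝒰 univ := by
      rw [tendstoLocallyUniformlyOn_univ]
      exact e.isometry.uniformContinuous.comp_tendstoLocallyUniformly (hunif (l + 1))
    refine hasFDerivAt_of_tendstoLocallyUniformlyOn (𝕜 := ℝ) isOpen_univ h1
      (fun f y _ => ?_) (fun y _ => hG y l) (mem_univ x)
    have h2 := ((f.1.smooth ⊤).differentiable_iteratedFDeriv (m := l)
      (mod_cast ENat.natCast_lt_top l) y).hasFDerivAt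
    rwa [fderiv_iteratedFDeriv] at h2
  have hT : HasFTaylorSeriesUpTo ∞ (fun x => (G x 0).curry0) (fun x l => G x l) :=
    ⟨fun x => rfl, fun m _ x => hderiv m x, fun m _ => continuous_iff_continuousAt.2 fun x =>
      (hderiv m x).continuousAt⟩
  have hGl : ∀ l x, iteratedFDeriv ℝ l (fun x => (G x 0).curry0) x = G x l := fun l x =>
    (hT.eq_iteratedFDeriv (mod_cast le_top) x).symm
  have hGb : ∀ k l x, ‖x‖ ^ k * ‖G x l‖ ≤ M k l := fun k l x =>
    le_of_tendsto ((hG x l).norm.const_mul _) (Eventually.of_forall fun f => hbd k l x f)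
  let g : 𝓢(Rn n, ℂ) :=
    { toFun := fun x => (G x 0).curry0
      smooth' := hT.contDiff
      decay' := fun k l => ⟨M k l, fun x => by rw [hGl]; exact hGb k l x⟩ }
  refine ⟨g, fun k l => SchwartzMap.seminorm_le_bound ℂ k l _ (hM k l) fun x => ?_, ?_⟩
  · change ‖x‖ ^ k * ‖iteratedFDeriv ℝ l (fun x => (G x 0).curry0) x‖ ≤ _
    rw [hGl]
    exact hGb k l x
  rw [(schwartz_withSeminorms ℂ (Rn n) ℂ).tendsto_nhds]
  rintro ⟨k, l⟩ ε hε
  -- Outside of the ball of radius `R`, the decay of order `k + 1` makes the difference small.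
  obtain ⟨R, hR0, hR⟩ : ∃ R : ℝ, 0 < R ∧ 2 * M (k + 1) l ≤ ε / 2 * R :=
    ⟨2 * M (k + 1) l / (ε / 2) + 1, by have := hM (k + 1) l; positivity, by
      have : ε / 2 * (2 * M (k + 1) l / (ε / 2)) = 2 * M (k + 1) l := by field_simp
      rw [mul_add, this]
      linarith⟩
  have hK := (tendstoLocallyUniformly_iff_forall_isCompact.1 (hunif l)) _
    (isCompact_closedBall (0 : Rn n) R)
  rw [Metric.tendstoUniformlyOn_iff] at hK
  filter_upwards [hK (ε / 2 / (R ^ k)) (by positivity)] with f hf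
  refine (SchwartzMap.seminorm_le_bound ℂ k l _ (half_pos hε).le fun x => ?_).trans_lt
    (half_lt_self hε)
  have hsub : iteratedFDeriv ℝ l (f.1 - g) x = iteratedFDeriv ℝ l f.1 x - G x l := by
    rw [← hGl]
    exact iteratedFDeriv_sub_apply ((f.1.smooth l).contDiffAt) ((g.smooth l).contDiffAt)
  rw [hsub]
  rcases le_or_gt ‖x‖ R with hx | hx
  · have h1 := hf x (by simpa using hx)
    rw [dist_comm, dist_eq_norm] at h1
    calc ‖x‖ ^ k * ‖iteratedFDeriv ℝ l f.1 x - G x l‖ ≤ R ^ k * (ε / 2 / R ^ k) := by gcongr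
      _ = ε / 2 := by field_simp
  · have h1 : ‖x‖ ^ (k + 1) * ‖iteratedFDeriv ℝ l f.1 x - G x l‖ ≤ 2 * M (k + 1) l := by
      have := norm_sub_le (iteratedFDeriv ℝ l f.1 x) (G x l)
      calc _ ≤ ‖x‖ ^ (k + 1) * (‖iteratedFDeriv ℝ l f.1 x‖ + ‖G x l‖) := by gcongr
        _ ≤ _ := by linarith [hbd (k + 1) l x f, hGb (k + 1) l x]
    refine le_of_mul_le_mul_right ?_ hR0
    calc _ ≤ ‖x‖ ^ k * ‖iteratedFDeriv ℝ l f.1 x - G x l‖ * ‖x‖ := by gcongr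
      _ = ‖x‖ ^ (k + 1) * ‖iteratedFDeriv ℝ l f.1 x - G x l‖ := by ring
      _ ≤ _ := h1.trans hR

lemma schwartzBall_mem_absConvexCompacts (M : ℕ → ℕ → ℝ) :
    schwartzBall (n := n) M ∈ absConvexCompacts 𝓢(Rn n, ℂ) := by
  refine ⟨balanced_schwartzBall M, convex_schwartzBall M, ?_⟩
  rw [isCompact_iff_compactSpace, ← isCompact_univ_iff, isCompact_iff_ultrafilter_le_nhds]
  intro 𝒰 _
  obtain ⟨g, hg, h⟩ := exists_limit_schwartzBall M 𝒰
  exact ⟨⟨g, hg⟩, mem_univ _, tendsto_subtype_rng.2 h⟩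

lemma exists_schwartzBall_of_isVonNBounded {B : Set 𝓢(Rn n, ℂ)} (hB : IsVonNBounded ℂ B) :
    ∃ M : ℕ → ℕ → ℝ, B ⊆ schwartzBall M := by
  rw [(schwartz_withSeminorms ℂ (Rn n) ℂ).isVonNBounded_iff_seminorm_bounded] at hB
  choose r _ hr using hB
  exact ⟨fun k l => r (k, l), fun f hf k l => (hr (k, l) f hf).le⟩

/-- `𝒮` is a Montel space. -/
lemma schwartz_montel {B : Set 𝓢(Rn n, ℂ)} (hB : IsVonNBounded ℂ B) :
    ∃ C ∈ absConvexCompacts 𝓢(Rn n, ℂ), B ⊆ C :=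
  let ⟨M, hM⟩ := exists_schwartzBall_of_isVonNBounded hB
  ⟨_, schwartzBall_mem_absConvexCompacts M, hM⟩

end Schwartz

lemma preimage_mem_absConvexCompacts {X Y : Type*} [AddCommGroup X] [Module ℂ X]
    [TopologicalSpace X] [AddCommGroup Y] [Module ℂ Y] [TopologicalSpace Y] (s : X →L[ℂ] Y)
    {C : Set Y} (hC : C ∈ absConvexCompacts Y) (h : IsCompact (s ⁻¹' C)) :
    s ⁻¹' C ∈ absConvexCompacts X := by
  refine ⟨fun a ha => ?_, hC.2.1.linear_preimage (s.toLinearMap.restrictScalars ℝ), h⟩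
  rintro _ ⟨x, hx, rfl⟩
  change s (a • x) ∈ C
  rw [map_smul]
  exact hC.1 a ha (smul_mem_smul_set hx)

section Test

variable {n : ℕ}

/-- A seminorm on `𝒟` is continuous as soon as on each `𝒟_K` it is bounded by finitely many
derivatives. -/
lemma continuous_seminorm_test (q : Seminorm ℂ (Test n))
    (h : ∀ K : Set (Rn n), IsCompact K → ∃ (N : ℕ) (C : ℝ), 0 ≤ C ∧ ∀ (φ : Test n) (A : ℝ),
      0 ≤ A → tsupport φ ⊆ K → (∀ m ≤ N, ∀ x, ‖iteratedFDeriv ℝ m φ x‖ ≤ A) → q φ ≤ C * A) :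
    Continuous q := by
  let p : SeminormFamily ℂ (Test n) Unit := fun _ => q
  let t₀ : TopologicalSpace (Test n) := inferInstance
  let t : TopologicalSpace (Test n) := p.moduleFilterBasis.topology
  have hp : @WithSeminorms ℂ (Test n) Unit _ _ _ p t := @WithSeminorms.mk _ _ _ _ _ _ _ t rfl
  have h1 : @Continuous (Test n) (Test n) t₀ t id :=
    @continuous_of_seminorm_bound (Test n) _ _ t n Unit p hp LinearMap.id fun _ => h
  have h2 : @Continuous (Test n) ℝ t _ q := @WithSeminorms.continuous_seminorm _ _ _ _ _ _ t p hp ()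
  exact @Continuous.comp _ _ _ t₀ t _ _ _ h2 h1

/-- The seminorm `φ ↦ ∑ a_j |φ(x_j)|` for a sequence of points that tends to infinity. -/
def pointSeminorm (a : ℕ → ℝ) (ha : ∀ j, 0 ≤ a j) (x : ℕ → Rn n) (hx : ∀ j : ℕ, (j : ℝ) ≤ ‖x j‖) :
    Seminorm ℂ (Test n) :=
  have hs : ∀ φ : Test n, Summable fun j => a j * ‖φ (x j)‖ := fun φ => by
    obtain ⟨R, hR⟩ := φ.hasCompactSupport.isBounded.exists_norm_le
    refine summable_of_hasFiniteSupport ((finite_Iic ⌈R⌉₊).subset fun j hj => ?_)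
    have h1 : φ (x j) ≠ 0 := fun h => hj (by simp [h])
    exact_mod_cast (hx j).trans ((hR _ (subset_tsupport _ h1)).trans (Nat.le_ceil R))
  Seminorm.of (fun φ => ∑' j, a j * ‖φ (x j)‖)
    (fun φ ψ => by
      rw [← (hs φ).tsum_add (hs ψ)]
      refine (hs (φ + ψ)).tsum_le_tsum (fun j => ?_) ((hs φ).add (hs ψ))
      rw [← mul_add]
      exact mul_le_mul_of_nonneg_left (norm_add_le _ _) (ha j))
    (fun c φ => by
      rw [← tsum_mul_left]
      refine tsum_congr fun j => ?_
      change a j * ‖c * φ (x j)‖ = _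
      rw [norm_mul]
      ring)

lemma continuous_pointSeminorm {a : ℕ → ℝ} (ha : ∀ j, 0 ≤ a j) {x : ℕ → Rn n}
    (hx : ∀ j : ℕ, (j : ℝ) ≤ ‖x j‖) : Continuous (pointSeminorm a ha x hx) := by
  refine continuous_seminorm_test _ fun K hK => ?_
  obtain ⟨R, hR⟩ := hK.isBounded.exists_norm_le
  refine ⟨0, ∑ j ∈ Finset.range (⌈R⌉₊ + 1), a j, Finset.sum_nonneg fun j _ => ha j,
    fun φ A hA hφ hD => ?_⟩
  change ∑' j, a j * ‖φ (x j)‖ ≤ _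
  rw [tsum_eq_sum (s := Finset.range (⌈R⌉₊ + 1)), Finset.sum_mul]
  · refine Finset.sum_le_sum fun j _ => mul_le_mul_of_nonneg_left ?_ (ha j)
    simpa using hD 0 le_rfl (x j)
  · intro j hj
    by_contra h0
    have h1 : φ (x j) ≠ 0 := fun h => h0 (by simp [h])
    have h2 : j ≤ ⌈R⌉₊ := by
      exact_mod_cast (hx j).trans ((hR _ (hφ (subset_tsupport _ h1))).trans (Nat.le_ceil R))
    exact hj (Finset.mem_range.2 (Nat.lt_succ_of_le h2))

lemma le_pointSeminorm {a : ℕ → ℝ} (ha : ∀ j, 0 ≤ a j) {x : ℕ → Rn n}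
    (hx : ∀ j : ℕ, (j : ℝ) ≤ ‖x j‖) (φ : Test n) (j : ℕ) :
    a j * ‖φ (x j)‖ ≤ pointSeminorm a ha x hx φ := by
  obtain ⟨R, hR⟩ := φ.hasCompactSupport.isBounded.exists_norm_le
  refine Summable.le_tsum (summable_of_hasFiniteSupport ((finite_Iic ⌈R⌉₊).subset fun j hj => ?_)) j
    fun i _ => mul_nonneg (ha i) (norm_nonneg (φ (x i)))
  have h1 : φ (x j) ≠ 0 := fun h => hj (by simp [h])
  exact_mod_cast (hx j).trans ((hR _ (subset_tsupport _ h1)).trans (Nat.le_ceil R))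

/-- The functions in a bounded subset of `𝒟` have their supports in a common ball. -/
lemma exists_closedBall_of_isVonNBounded {B : Set (Test n)} (hB : IsVonNBounded ℂ B) :
    ∃ R : ℝ, ∀ φ ∈ B, tsupport φ ⊆ Metric.closedBall 0 R := by
  by_contra! hne
  have h1 : ∀ j : ℕ, ∃ φ ∈ B, ∃ x : Rn n, (j : ℝ) ≤ ‖x‖ ∧ φ x ≠ 0 := by
    intro j
    obtain ⟨φ, hφ, hn⟩ := hne j
    by_contra! h0
    refine hn (closure_minimal (fun x hx => ?_) Metric.isClosed_closedBall)
    by_contra hxj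
    rw [mem_closedBall_zero_iff, not_le] at hxj
    exact hx (h0 φ hφ x hxj.le)
  choose φ hφ x hx hφx using h1
  -- The weights are such that this seminorm is at least `j` at `φ j`.
  have ha : ∀ j : ℕ, 0 ≤ (j : ℝ) * ‖φ j (x j)‖⁻¹ := fun j => by positivity
  obtain ⟨r, hr⟩ := isVonNBounded_iff_seminorm.1 hB _ (continuous_pointSeminorm ha hx)
  obtain ⟨j, hj⟩ := exists_nat_gt r
  have h2 := (le_pointSeminorm ha hx (φ j) j).trans (hr _ (hφ j))
  rw [inv_mul_cancel_right₀ (norm_ne_zero_iff.2 (hφx j))] at h2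
  linarith

lemma exists_bound_of_isVonNBounded {B : Set (Test n)} (hB : IsVonNBounded ℂ B) (N : ℕ) :
    ∃ A, 0 ≤ A ∧ ∀ φ ∈ B, ∀ m ≤ N, ∀ x, ‖iteratedFDeriv ℝ m φ x‖ ≤ A := by
  obtain ⟨M, hM⟩ := exists_schwartzBall_of_isVonNBounded (hB.image (testToSchwartz n))
  refine ⟨∑ m ∈ Finset.range (N + 1), |M 0 m|, Finset.sum_nonneg fun m _ => abs_nonneg _,
    fun φ hφ m hm x => ?_⟩
  have h1 := (SchwartzMap.le_seminorm ℂ 0 m (testToSchwartz n φ) x).trans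
    (hM (mem_image_of_mem _ hφ) 0 m)
  rw [pow_zero, one_mul] at h1
  exact (h1.trans (le_abs_self _)).trans (Finset.single_le_sum (f := fun m => |M 0 m|)
    (fun i _ => abs_nonneg _) (Finset.mem_range.2 (Nat.lt_succ_of_le hm)))

/-- A set of test functions with supports in a common compact set is bounded as soon as the
derivatives of each order are bounded. -/
lemma isVonNBounded_test {B : Set (Test n)} {K : Set (Rn n)} (hK : IsCompact K)
    (hBK : ∀ φ ∈ B, tsupport φ ⊆ K)
    (h : ∀ N : ℕ, ∃ A, 0 ≤ A ∧ ∀ φ ∈ B, ∀ m ≤ N, ∀ x, ‖iteratedFDeriv ℝ m φ x‖ ≤ A) :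
    IsVonNBounded ℂ B := by
  let K' : TopologicalSpace.Compacts (Rn n) := ⟨K, hK⟩
  let j := TestFunction.ofSupportedInCLM ℂ (n := ⊤) (F := ℂ) (Ω := ⊤) (K := K') (subset_univ _)
  have hB : IsVonNBounded ℂ (j ⁻¹' B) := by
    rw [(ContDiffMapSupportedIn.withSeminorms ℂ (Rn n) ℂ ⊤ K').isVonNBounded_iff_seminorm_bounded]
    intro i
    obtain ⟨A, hA, hAB⟩ := h i
    refine ⟨A + 1, by positivity, fun f hf => lt_of_le_of_lt ?_ (lt_add_one A)⟩
    rw [ContDiffMapSupportedIn.seminorm_top_le_iff ℂ hA]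
    exact fun x _ => hAB _ hf i le_rfl x
  refine (hB.image j).subset fun φ hφ => ?_
  let f : 𝓓^{⊤}_{K'}(Rn n, ℂ) := ⟨φ, φ.contDiff, fun x hx => by
    by_contra h0
    exact hx (hBK φ hφ (subset_tsupport _ h0))⟩
  exact ⟨f, hφ, rfl⟩

/-- `𝒟` is a Montel space. -/
lemma test_montel {B : Set (Test n)} (hB : IsVonNBounded ℂ B) :
    ∃ C ∈ absConvexCompacts (Test n), B ⊆ C := by
  obtain ⟨R, hR⟩ := exists_closedBall_of_isVonNBounded hB
  obtain ⟨M, hM⟩ := exists_schwartzBall_of_isVonNBounded (hB.image (testToSchwartz n))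
  let K : TopologicalSpace.Compacts (Rn n) := ⟨Metric.closedBall 0 R, isCompact_closedBall 0 R⟩
  let j := TestFunction.ofSupportedInCLM ℂ (n := ⊤) (F := ℂ) (Ω := ⊤) (K := K) (subset_univ _)
  let s : 𝓓^{⊤}_{K}(Rn n, ℂ) →L[ℂ] 𝓢(Rn n, ℂ) := (testToSchwartz n).comp j
  have hC : s ⁻¹' schwartzBall M ∈ absConvexCompacts 𝓓^{⊤}_{K}(Rn n, ℂ) := by
    refine preimage_mem_absConvexCompacts s (schwartzBall_mem_absConvexCompacts M) ?_
    rw [isCompact_iff_ultrafilter_le_nhds]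
    intro 𝒰 h𝒰
    obtain ⟨g, hg, h⟩ := (schwartzBall_mem_absConvexCompacts M).2.2.ultrafilter_le_nhds (𝒰.map s)
      (by rwa [le_principal_iff] at h𝒰 ⊢)
    have hev : ∀ x, Tendsto (fun f : 𝓓^{⊤}_{K}(Rn n, ℂ) => f x) 𝒰 (𝓝 (g x)) := fun x => by
      have h1 := (schwartz_withSeminorms ℂ (Rn n) ℂ).tendsto_nhds s g |>.1 h (0, 0)
      rw [Metric.tendsto_nhds]
      intro ε hε
      filter_upwards [h1 ε hε] with f hf
      rw [dist_eq_norm]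
      exact (SchwartzMap.norm_le_seminorm ℂ (s f - g) x).trans_lt hf
    let f₀ : 𝓓^{⊤}_{K}(Rn n, ℂ) := ⟨g, g.smooth ⊤, fun x hx => by
      refine tendsto_nhds_unique (hev x) (tendsto_const_nhds.congr fun f => ?_)
      exact (f.zero_on_compl hx).symm⟩
    refine ⟨f₀, hg, ?_⟩
    change Tendsto id (𝒰 : Filter _) (𝓝 f₀)
    rw [(ContDiffMapSupportedIn.withSeminorms ℂ (Rn n) ℂ ⊤ K).tendsto_nhds]
    intro i ε hε
    filter_upwards [(schwartz_withSeminorms ℂ (Rn n) ℂ).tendsto_nhds s g |>.1 h (0, i) ε hε]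
      with f hf
    refine lt_of_le_of_lt ?_ hf
    rw [ContDiffMapSupportedIn.seminorm_top_le_iff ℂ (apply_nonneg _ _)]
    intro x _
    have := SchwartzMap.le_seminorm ℂ 0 i (s f - g) x
    rwa [pow_zero, one_mul] at this
  refine ⟨_, absConvexCompacts_image j hC, fun φ hφ => ?_⟩
  let f : 𝓓^{⊤}_{K}(Rn n, ℂ) := ⟨φ, φ.contDiff, fun x hx => by
    by_contra h0
    exact hx (hR φ hφ (subset_tsupport _ h0))⟩
  exact ⟨f, hM (mem_image_of_mem _ hφ), rfl⟩

end Test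

/-! ### Products and cut-off functions -/

section Leibniz

variable {n : ℕ}

lemma norm_iteratedFDeriv_mul_le_of_le {f g : Rn n → ℂ} (hf : ContDiff ℝ ∞ f) (hg : ContDiff ℝ ∞ g)
    {x : Rn n} {N : ℕ} {A B : ℝ} (hA : ∀ m ≤ N, ‖iteratedFDeriv ℝ m f x‖ ≤ A)
    (hB : ∀ m ≤ N, ‖iteratedFDeriv ℝ m g x‖ ≤ B) {m : ℕ} (hm : m ≤ N) :
    ‖iteratedFDeriv ℝ m (fun y => f y * g y) x‖ ≤ 2 ^ N * (A * B) := by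
  have hA0 : 0 ≤ A := (norm_nonneg _).trans (hA 0 (Nat.zero_le N))
  have hB0 : 0 ≤ B := (norm_nonneg _).trans (hB 0 (Nat.zero_le N))
  refine (norm_iteratedFDeriv_mul_le hf hg x (n := m) (mod_cast le_top)).trans ?_
  calc _ ≤ ∑ i ∈ Finset.range (m + 1), (m.choose i : ℝ) * (A * B) := by
        refine Finset.sum_le_sum fun i hi => ?_
        rw [mul_assoc]
        have h1 := hA i ((Nat.lt_succ_iff.1 (Finset.mem_range.1 hi)).trans hm)
        have h2 := hB (m - i) ((Nat.sub_le m i).trans hm)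
        gcongr
    _ = 2 ^ m * (A * B) := by
        rw [← Finset.sum_mul]
        congr 1
        exact_mod_cast Nat.sum_range_choose m
    _ ≤ 2 ^ N * (A * B) := by
        gcongr
        norm_num

lemma norm_iteratedFDeriv_le_schwartz (f : 𝓢(Rn n, ℂ)) (k l : ℕ) (x : Rn n) {m : ℕ} (hm : m ≤ l) :
    ‖iteratedFDeriv ℝ m f x‖ ≤ 2 ^ k * (Finset.Iic (k, l)).sup
      (fun m => SchwartzMap.seminorm ℂ m.1 m.2) f / (1 + ‖x‖) ^ k := by
  rw [le_div_iff₀ (by positivity), mul_comm]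
  exact SchwartzMap.one_add_le_sup_seminorm_apply (𝕜 := ℂ) (m := (k, l)) le_rfl hm f x

/-- The growth of order `j` of `g` is absorbed by the seminorms of order `k + j` of `f`. -/
lemma pow_mul_norm_iteratedFDeriv_mul_le (f : 𝓢(Rn n, ℂ)) {g : Rn n → ℂ} (hg : ContDiff ℝ ∞ g)
    {j l : ℕ} {A : ℝ} (h : GrowthBound g j l A) (k : ℕ) (x : Rn n) :
    ‖x‖ ^ k * ‖iteratedFDeriv ℝ l (fun y => f y * g y) x‖ ≤
      2 ^ l * (2 ^ (k + j) * (Finset.Iic (k + j, l)).sup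
        (fun m => SchwartzMap.seminorm ℂ m.1 m.2) f) * A := by
  have h1 := norm_iteratedFDeriv_mul_le_of_le (f.smooth ⊤) hg
    (fun m hm => norm_iteratedFDeriv_le_schwartz f (k + j) l x hm) (fun m hm => h m hm x) le_rfl
  set S := (Finset.Iic (k + j, l)).sup (fun m => SchwartzMap.seminorm ℂ m.1 m.2) f
  have hx : 0 < 1 + ‖x‖ := by positivity
  calc _ ≤ (1 + ‖x‖) ^ k *
      (2 ^ l * (2 ^ (k + j) * S / (1 + ‖x‖) ^ (k + j) * (A * (1 + ‖x‖) ^ j))) := by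
        gcongr
        linarith
    _ = _ := by
        rw [pow_add (1 + ‖x‖)]
        field_simp

end Leibniz

section Topologies

variable (n : ℕ)

lemma smooth_withSeminorms : WithSeminorms (smoothSeminormFamily n) := ⟨rfl⟩

lemma oc_withSeminorms : WithSeminorms (ocSeminormFamily n) := ⟨rfl⟩

instance : IsTopologicalAddGroup (Smooth n) := (smooth_withSeminorms n).topologicalAddGroup

instance : ContinuousSMul ℂ (Smooth n) := (smooth_withSeminorms n).continuousSMul

instance : LocallyConvexSpace ℝ (Smooth n) := (smooth_withSeminorms n).toLocallyConvexSpace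

instance : IsTopologicalAddGroup (OC n) := (oc_withSeminorms n).topologicalAddGroup

instance : ContinuousSMul ℂ (OC n) := (oc_withSeminorms n).continuousSMul

instance : LocallyConvexSpace ℝ (OC n) := (oc_withSeminorms n).toLocallyConvexSpace

variable {n}

/-- A pointwise bounded family of seminorms with a continuous supremum is uniformly bounded on
bounded sets. -/
lemma exists_bound_of_continuous_iSup {Y : Type*} [AddCommGroup Y] [Module ℂ Y] [TopologicalSpace Y]
    [IsTopologicalAddGroup Y] [ContinuousSMul ℂ Y] [LocallyConvexSpace ℝ Y] {α : Type*}
    {F : α → Seminorm ℂ Y} (h : ∀ y, BddAbove (range fun a => F a y))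
    (hc : Continuous (⨆ a, F a : Seminorm ℂ Y)) {B : Set Y} (hB : IsVonNBounded ℂ B) :
    ∃ r : ℝ, ∀ a, ∀ y ∈ B, F a y ≤ r := by
  obtain ⟨r, hr⟩ := isVonNBounded_iff_seminorm.1 hB _ hc
  refine ⟨r, fun a y hy => le_trans ?_ (hr y hy)⟩
  rw [Seminorm.iSup_apply (Seminorm.bddAbove_range_iff.2 h)]
  exact le_ciSup (h y) a

lemma iSup_seminorm_le {Y : Type*} [AddCommGroup Y] [Module ℂ Y] {α : Type*}
    {F : α → Seminorm ℂ Y} (h : ∀ y, BddAbove (range fun a => F a y)) {y : Y} {r : ℝ} (hr : 0 ≤ r)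
    (hF : ∀ a, F a y ≤ r) : (⨆ a, F a : Seminorm ℂ Y) y ≤ r := by
  rw [Seminorm.iSup_apply (Seminorm.bddAbove_range_iff.2 h)]
  exact Real.iSup_le hF hr

end Topologies

section MulTest

variable {n : ℕ}

/-- The multiplication `𝒟 × 𝓔 → 𝒟`. -/
def mulTestSmooth (n : ℕ) : Test n →ₗ[ℂ] Smooth n →ₗ[ℂ] Test n :=
  LinearMap.mk₂ ℂ (fun φ g => ⟨fun x => φ x * g.1 x, φ.contDiff.mul g.2,
      φ.hasCompactSupport.mul_right, fun _ _ => trivial⟩)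
    (fun φ ψ g => by ext x; exact add_mul (φ x) (ψ x) (g.1 x))
    (fun c φ g => by ext x; exact mul_assoc c (φ x) (g.1 x))
    (fun φ g h => by ext x; exact mul_add (φ x) (g.1 x) (h.1 x))
    (fun c φ g => by ext x; exact mul_left_comm (φ x) c (g.1 x))

lemma tsupport_mulTestSmooth (φ : Test n) (g : Smooth n) :
    tsupport (mulTestSmooth n φ g) ⊆ tsupport φ :=
  tsupport_mul_subset_left (f := φ) (g := g.1)

lemma norm_iteratedFDeriv_mulTestSmooth_le {φ : Test n} {g : Smooth n} {K : Set (Rn n)}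
    (hK : tsupport φ ⊆ K) {N : ℕ} {A B : ℝ} (hA : ∀ m ≤ N, ∀ x, ‖iteratedFDeriv ℝ m φ x‖ ≤ A)
    (hB0 : 0 ≤ B) (hB : ∀ m ≤ N, ∀ x ∈ K, ‖iteratedFDeriv ℝ m g.1 x‖ ≤ B) {m : ℕ} (hm : m ≤ N)
    (x : Rn n) : ‖iteratedFDeriv ℝ m (mulTestSmooth n φ g) x‖ ≤ 2 ^ N * A * B := by
  have hA0 : 0 ≤ A := (norm_nonneg _).trans (hA 0 (Nat.zero_le N) 0)
  by_cases hx : x ∈ K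
  · rw [mul_assoc]
    exact norm_iteratedFDeriv_mul_le_of_le φ.contDiff g.2 (fun m hm => hA m hm x)
      (fun m hm => hB m hm x hx) hm
  · have : iteratedFDeriv ℝ m (mulTestSmooth n φ g) x = 0 := by
      by_contra h
      exact hx (hK (tsupport_mulTestSmooth φ g (support_iteratedFDeriv_subset m h)))
    rw [this, norm_zero]
    positivity

lemma continuous_mulTestSmooth (φ : Test n) : Continuous (mulTestSmooth n φ) := by
  let K : TopologicalSpace.Compacts (Rn n) := ⟨tsupport φ, φ.hasCompactSupport⟩
  let j := TestFunction.ofSupportedInCLM ℂ (n := ⊤) (F := ℂ) (Ω := ⊤) (K := K) (subset_univ _)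
  let f : Smooth n →ₗ[ℂ] 𝓓^{⊤}_{K}(Rn n, ℂ) :=
    { toFun := fun g => ⟨mulTestSmooth n φ g, (mulTestSmooth n φ g).contDiff, fun x hx => by
        by_contra h0
        exact hx (tsupport_mulTestSmooth φ g (subset_tsupport _ h0))⟩
      map_add' := fun g h => by ext x; exact mul_add (φ x) (g.1 x) (h.1 x)
      map_smul' := fun c g => by ext x; exact mul_left_comm (φ x) c (g.1 x) }
  have hf : Continuous f := by
    refine (ContDiffMapSupportedIn.withSeminorms ℂ (Rn n) ℂ ⊤ K).continuous_of_continuous_comp f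
      fun i => ?_
    obtain ⟨A, hA, h⟩ := test_growthBound φ i
    refine (smooth_withSeminorms n).continuous_seminorm ⟨_, K, i, 2 ^ i * A, K.isCompact,
      by positivity, fun g B hB0 hB => ?_⟩
    change ContDiffMapSupportedIn.seminorm ℂ (Rn n) ℂ ⊤ K i (f g) ≤ _
    rw [ContDiffMapSupportedIn.seminorm_top_le_iff ℂ (by positivity)]
    exact fun x _ => norm_iteratedFDeriv_mulTestSmooth_le subset_rfl
      (fun m hm x => by simpa using h m hm x) hB0 hB le_rfl x
  exact j.continuous.comp hf

lemma isVonNBounded_mulTestSmooth {S : Set (Test n)} {T : Set (Smooth n)} (hS : IsVonNBounded ℂ S)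
    (hT : IsVonNBounded ℂ T) :
    IsVonNBounded ℂ (image2 (fun φ g => mulTestSmooth n φ g) S T) := by
  obtain ⟨R, hR⟩ := exists_closedBall_of_isVonNBounded hS
  refine isVonNBounded_test (isCompact_closedBall (0 : Rn n) R) ?_ fun N => ?_
  · rintro _ ⟨φ, hφ, g, hg, rfl⟩
    exact (tsupport_mulTestSmooth φ g).trans (hR φ hφ)
  -- For fixed `l`, the supremum over `φ ∈ S` of the norms of the `l`-th derivative of `φ g` is a
  -- continuous seminorm in `g`.
  have key : ∀ l : ℕ, ∃ r : ℝ, ∀ φ ∈ S, ∀ g ∈ T, ∀ x,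
      ‖iteratedFDeriv ℝ l (mulTestSmooth n φ g) x‖ ≤ r := by
    intro l
    obtain ⟨A, hA0, hA⟩ := exists_bound_of_isVonNBounded hS l
    let F : S → Seminorm ℂ (Smooth n) := fun φ =>
      (SchwartzMap.seminorm ℂ 0 l).comp ((testToSchwartz n).toLinearMap ∘ₗ mulTestSmooth n φ)
    have hF : ∀ (φ : S) (g : Smooth n) (B : ℝ), 0 ≤ B →
        (∀ m ≤ l, ∀ x ∈ Metric.closedBall (0 : Rn n) R, ‖iteratedFDeriv ℝ m g.1 x‖ ≤ B) →
        F φ g ≤ 2 ^ l * A * B := fun φ g B hB0 hB => by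
      refine SchwartzMap.seminorm_le_bound ℂ 0 l _ (by positivity) fun x => ?_
      rw [pow_zero, one_mul]
      exact norm_iteratedFDeriv_mulTestSmooth_le (hR φ φ.2) (hA φ φ.2) hB0 hB le_rfl x
    have hbdd : ∀ g, BddAbove (range fun φ => F φ g) := fun g => by
      have h1 : ∀ m : ℕ, ∃ B, ∀ x ∈ Metric.closedBall (0 : Rn n) R,
          ‖iteratedFDeriv ℝ m g.1 x‖ ≤ B := fun m =>
        (isCompact_closedBall (0 : Rn n) R).exists_bound_of_continuousOn
          (ContDiff.continuous_iteratedFDeriv (n := ∞) (mod_cast le_top) g.2).continuousOn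
      choose B hB using h1
      refine ⟨2 ^ l * A * ∑ m ∈ Finset.range (l + 1), |B m|, ?_⟩
      rintro _ ⟨φ, rfl⟩
      refine hF φ g _ (Finset.sum_nonneg fun m _ => abs_nonneg _) fun m hm x hx => ?_
      exact ((hB m x hx).trans (le_abs_self _)).trans (Finset.single_le_sum (f := fun m => |B m|)
        (fun i _ => abs_nonneg _) (Finset.mem_range.2 (Nat.lt_succ_of_le hm)))
    obtain ⟨r, hr⟩ := exists_bound_of_continuous_iSup hbdd
      ((smooth_withSeminorms n).continuous_seminorm ⟨⨆ φ, F φ, Metric.closedBall 0 R, l, 2 ^ l * A,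
        isCompact_closedBall _ _, by positivity, fun g B hB0 hB =>
          iSup_seminorm_le hbdd (by positivity) fun φ => hF φ g B hB0 hB⟩) hT
    refine ⟨r, fun φ hφ g hg x => le_trans ?_ (hr ⟨φ, hφ⟩ g hg)⟩
    have := SchwartzMap.le_seminorm ℂ 0 l (testToSchwartz n (mulTestSmooth n φ g)) x
    rwa [pow_zero, one_mul] at this
  choose r hr using key
  refine ⟨∑ m ∈ Finset.range (N + 1), |r m|, Finset.sum_nonneg fun m _ => abs_nonneg _, ?_⟩
  rintro _ ⟨φ, hφ, g, hg, rfl⟩ m hm x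
  exact ((hr m φ hφ g hg x).trans (le_abs_self _)).trans (Finset.single_le_sum
    (f := fun m => |r m|) (fun i _ => abs_nonneg _) (Finset.mem_range.2 (Nat.lt_succ_of_le hm)))

end MulTest

section MulSchwartz

variable {n : ℕ}

/-- The multiplication `𝒮 × 𝓞_C → 𝒮`. -/
def mulSchwartzOC (n : ℕ) : 𝓢(Rn n, ℂ) →ₗ[ℂ] OC n →ₗ[ℂ] 𝓢(Rn n, ℂ) :=
  LinearMap.mk₂ ℂ (fun f g =>
      { toFun := fun x => f x * g.1 x
        smooth' := (f.smooth ⊤).mul g.2.1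
        decay' := fun k l => by
          obtain ⟨j, hj⟩ := g.2.2
          obtain ⟨A, -, hA⟩ := hj l
          exact ⟨_, pow_mul_norm_iteratedFDeriv_mul_le f g.2.1 hA k⟩ })
    (fun f f' g => by ext x; exact add_mul (f x) (f' x) (g.1 x))
    (fun c f g => by ext x; exact mul_assoc c (f x) (g.1 x))
    (fun f g h => by ext x; exact mul_add (f x) (g.1 x) (h.1 x))
    (fun c f g => by ext x; exact mul_left_comm (f x) c (g.1 x))

lemma seminorm_mulSchwartzOC_le (f : 𝓢(Rn n, ℂ)) (g : OC n) {j l : ℕ} {A : ℝ} (hA : 0 ≤ A)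
    (h : GrowthBound g.1 j l A) (k : ℕ) :
    SchwartzMap.seminorm ℂ k l (mulSchwartzOC n f g) ≤
      2 ^ l * (2 ^ (k + j) * (Finset.Iic (k + j, l)).sup
        (fun m => SchwartzMap.seminorm ℂ m.1 m.2) f) * A :=
  SchwartzMap.seminorm_le_bound ℂ k l _ (by positivity)
    (pow_mul_norm_iteratedFDeriv_mul_le f g.2.1 h k)

lemma continuous_mulSchwartzOC (f : 𝓢(Rn n, ℂ)) : Continuous (mulSchwartzOC n f) := by
  refine (schwartz_withSeminorms ℂ (Rn n) ℂ).continuous_of_continuous_comp _ ?_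
  rintro ⟨k, l⟩
  exact (oc_withSeminorms n).continuous_seminorm ⟨_, fun j => ⟨l, _, by positivity,
    fun g A _ hA h => seminorm_mulSchwartzOC_le f g hA h k⟩⟩

lemma isVonNBounded_mulSchwartzOC {S : Set 𝓢(Rn n, ℂ)} {T : Set (OC n)} (hS : IsVonNBounded ℂ S)
    (hT : IsVonNBounded ℂ T) :
    IsVonNBounded ℂ (image2 (fun f g => mulSchwartzOC n f g) S T) := by
  rw [(schwartz_withSeminorms ℂ (Rn n) ℂ).isVonNBounded_iff_seminorm_bounded]
  rintro ⟨k, l⟩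
  have hS' := (schwartz_withSeminorms ℂ (Rn n) ℂ).isVonNBounded_iff_finset_seminorm_bounded.1 hS
  -- The supremum of these seminorms over `f ∈ S` is a continuous seminorm in `g`.
  let F : S → Seminorm ℂ (OC n) := fun f => (SchwartzMap.seminorm ℂ k l).comp (mulSchwartzOC n f)
  have hF : ∀ j : ℕ, ∃ C : ℝ, 0 ≤ C ∧ ∀ (f : S) (g : OC n) (A : ℝ), 0 ≤ A →
      GrowthBound g.1 j l A → F f g ≤ C * A := fun j => by
    obtain ⟨r, hr0, hr⟩ := hS' (Finset.Iic (k + j, l))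
    refine ⟨2 ^ l * (2 ^ (k + j) * r), by positivity, fun f g A hA h => ?_⟩
    refine (seminorm_mulSchwartzOC_le f.1 g hA h k).trans ?_
    gcongr
    exact (hr f f.2).le
  have hbdd : ∀ g, BddAbove (range fun f => F f g) := fun g => by
    obtain ⟨j, hj⟩ := g.2.2
    obtain ⟨A, hA0, hA⟩ := hj l
    obtain ⟨C, -, hC⟩ := hF j
    refine ⟨C * A, ?_⟩
    rintro _ ⟨f, rfl⟩
    exact hC f g A hA0 hA
  obtain ⟨r, hr⟩ := exists_bound_of_continuous_iSup hbdd
    ((oc_withSeminorms n).continuous_seminorm ⟨⨆ f, F f, fun j => by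
      obtain ⟨C, hC0, hC⟩ := hF j
      exact ⟨l, C, hC0, fun g A _ hA h =>
        iSup_seminorm_le hbdd (by positivity) fun f => hC f g A hA h⟩⟩) hT
  refine ⟨max r 0 + 1, by positivity, ?_⟩
  rintro _ ⟨f, hf, g, hg, rfl⟩
  exact lt_of_le_of_lt ((hr ⟨f, hf⟩ g hg).trans (le_max_left r 0)) (lt_add_one _)

end MulSchwartz

section CutOff

variable {n : ℕ}

/-- A smooth function that is equal to `1` on the ball of radius `j + 1`. It is obtained by dilation
from a fixed function, so that its derivatives are bounded uniformly in `j`. -/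
def cutOff (n j : ℕ) (x : Rn n) : ℂ :=
  (((⟨1, 2, one_pos, one_lt_two⟩ : ContDiffBump (0 : Rn n)) ((j + 1 : ℝ)⁻¹ • x) : ℝ) : ℂ)

lemma contDiff_bump : ContDiff ℝ ∞ fun x : Rn n =>
    (((⟨1, 2, one_pos, one_lt_two⟩ : ContDiffBump (0 : Rn n)) x : ℝ) : ℂ) :=
  Complex.ofRealCLM.contDiff.comp (ContDiffBump.contDiff _)

lemma contDiff_cutOff (j : ℕ) : ContDiff ℝ ∞ (cutOff n j) :=
  contDiff_bump.comp (contDiff_const_smul _)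

lemma cutOff_eq_one {j : ℕ} {x : Rn n} (hx : ‖x‖ ≤ j + 1) : cutOff n j x = 1 := by
  rw [cutOff, ContDiffBump.one_of_mem_closedBall, Complex.ofReal_one]
  rw [mem_closedBall_zero_iff, norm_smul, norm_inv, Real.norm_of_nonneg (by positivity),
    inv_mul_le_iff₀ (by positivity), mul_one]
  exact hx

lemma hasCompactSupport_cutOff (j : ℕ) : HasCompactSupport (cutOff n j) := by
  refine HasCompactSupport.intro (isCompact_closedBall (0 : Rn n) (2 * (j + 1))) fun x hx => ?_
  rw [mem_closedBall_zero_iff, not_le] at hx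
  rw [cutOff, ContDiffBump.zero_of_le_dist, Complex.ofReal_zero]
  rw [dist_zero_right, norm_smul, norm_inv, Real.norm_of_nonneg (by positivity),
    le_inv_mul_iff₀ (by positivity), mul_comm]
  exact hx.le

lemma exists_cutOff_bound (n N : ℕ) :
    ∃ A, 0 ≤ A ∧ ∀ j, ∀ m ≤ N, ∀ x, ‖iteratedFDeriv ℝ m (cutOff n j) x‖ ≤ A := by
  let φ : Test n := ⟨_, contDiff_bump, ((ContDiffBump.hasCompactSupport
    (⟨1, 2, one_pos, one_lt_two⟩ : ContDiffBump (0 : Rn n))).comp_left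
      (g := fun t : ℝ => (t : ℂ)) Complex.ofReal_zero), fun _ _ => trivial⟩
  obtain ⟨A, hA0, hA⟩ := test_growthBound φ N
  refine ⟨A, hA0, fun j m hm x => ?_⟩
  let L : Rn n →L[ℝ] Rn n := (j + 1 : ℝ)⁻¹ • ContinuousLinearMap.id ℝ (Rn n)
  have hL : ‖L‖ ≤ 1 := by
    refine ContinuousLinearMap.opNorm_le_bound _ zero_le_one fun y => ?_
    change ‖(j + 1 : ℝ)⁻¹ • y‖ ≤ 1 * ‖y‖
    rw [norm_smul, norm_inv, Real.norm_of_nonneg (by positivity)]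
    gcongr
    exact inv_le_one_of_one_le₀ (by linarith [Nat.cast_nonneg (α := ℝ) j])
  have h1 : cutOff n j = φ ∘ L := rfl
  rw [h1, L.iteratedFDeriv_comp_right φ.contDiff x (mod_cast le_top)]
  refine (ContinuousMultilinearMap.norm_compContinuousLinearMap_le _ _).trans ?_
  rw [Finset.prod_const]
  have h2 := hA m hm (L x)
  rw [pow_zero, mul_one] at h2
  exact (mul_le_of_le_one_right (norm_nonneg _) (pow_le_one₀ (norm_nonneg _) hL)).trans h2

/-- The product of a smooth function and a cut-off function. -/
def cutTest (f : Rn n → ℂ) (hf : ContDiff ℝ ∞ f) (j : ℕ) : Test n :=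
  ⟨fun x => cutOff n j x * f x, (contDiff_cutOff j).mul hf,
    (hasCompactSupport_cutOff j).mul_right, fun _ _ => trivial⟩

lemma cutTest_sub_eventuallyEq {f : Rn n → ℂ} (hf : ContDiff ℝ ∞ f) {j : ℕ} {x : Rn n}
    (hx : ‖x‖ < j + 1) : (⇑(cutTest f hf j) - f) =ᶠ[𝓝 x] 0 := by
  filter_upwards [(continuous_norm.tendsto x).eventually_lt_const hx] with y hy
  change cutOff n j y * f y - f y = 0
  rw [cutOff_eq_one hy.le, one_mul, sub_self]

lemma iteratedFDeriv_cutTest_sub {f : Rn n → ℂ} (hf : ContDiff ℝ ∞ f) {j : ℕ} {x : Rn n}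
    (hx : ‖x‖ < j + 1) (m : ℕ) : iteratedFDeriv ℝ m (⇑(cutTest f hf j) - f) x = 0 := by
  rw [((cutTest_sub_eventuallyEq hf hx).iteratedFDeriv ℝ m).eq_of_nhds]
  simp [Pi.zero_def]

/-- Cutting off costs one power of `1 + |x|` in the growth, and gains a factor `1 / (j + 1)`. -/
lemma exists_growthBound_cutTest_sub {f : Rn n → ℂ} (hf : ContDiff ℝ ∞ f) {k N : ℕ} {A : ℝ}
    (hA : 0 ≤ A) (h : GrowthBound f k N A) :
    ∃ C, 0 ≤ C ∧ ∀ j : ℕ, GrowthBound (⇑(cutTest f hf j) - f) (k + 1) N (C / (j + 1)) := by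
  obtain ⟨D, hD0, hD⟩ := exists_cutOff_bound n N
  refine ⟨2 ^ N * (D * A) + A, by positivity, fun j m hm x => ?_⟩
  rcases lt_or_ge ‖x‖ (j + 1 : ℝ) with hx | hx
  · rw [iteratedFDeriv_cutTest_sub hf hx, norm_zero]
    positivity
  have h1 : ‖iteratedFDeriv ℝ m (cutTest f hf j) x‖ ≤ 2 ^ N * (D * (A * (1 + ‖x‖) ^ k)) :=
    norm_iteratedFDeriv_mul_le_of_le (contDiff_cutOff j) hf (fun m hm => hD j m hm x)
      (fun m hm => h m hm x) hm
  have h2 : iteratedFDeriv ℝ m (⇑(cutTest f hf j) - f) x =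
      iteratedFDeriv ℝ m (cutTest f hf j) x - iteratedFDeriv ℝ m f x :=
    iteratedFDeriv_sub_apply ((cutTest f hf j).contDiff.of_le (mod_cast le_top)).contDiffAt
      (hf.of_le (mod_cast le_top)).contDiffAt
  rw [h2, div_mul_eq_mul_div, le_div_iff₀ (by positivity)]
  calc _ ≤ (2 ^ N * (D * (A * (1 + ‖x‖) ^ k)) + A * (1 + ‖x‖) ^ k) * (1 + ‖x‖) := by
        have h3 : (j + 1 : ℝ) ≤ 1 + ‖x‖ := by linarith
        have h4 := (norm_sub_le (iteratedFDeriv ℝ m (cutTest f hf j) x)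
          (iteratedFDeriv ℝ m f x)).trans (add_le_add h1 (h m hm x))
        gcongr
    _ = _ := by ring

lemma tendsto_cutTest_oc (f : OC n) :
    Tendsto (fun j => testToOC n (cutTest f.1 f.2.1 j)) atTop (𝓝 f) := by
  rw [(oc_withSeminorms n).tendsto_nhds]
  rintro ⟨q, hq⟩ ε hε
  obtain ⟨k, hk⟩ := f.2.2
  obtain ⟨N, C, hC0, hC⟩ := hq (k + 1)
  obtain ⟨A, hA0, hA⟩ := hk N
  obtain ⟨D, hD0, hD⟩ := exists_growthBound_cutTest_sub f.2.1 hA0 hA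
  have h0 : Tendsto (fun j : ℕ => C * (D / (j + 1))) atTop (𝓝 0) := by
    have := (tendsto_one_div_add_atTop_nhds_zero_nat (𝕜 := ℝ)).const_mul (C * D)
    rw [mul_zero] at this
    exact this.congr fun j => by ring
  filter_upwards [h0.eventually_lt_const hε] with j hj
  refine lt_of_le_of_lt (hC _ _ (fun M => ?_) (by positivity) (hD j)) hj
  obtain ⟨A', hA0', hA'⟩ := hk M
  obtain ⟨D', -, hD'⟩ := exists_growthBound_cutTest_sub f.2.1 hA0' hA'
  exact ⟨_, hD' j⟩

lemma tendsto_cutTest_smooth (f : Smooth n) :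
    Tendsto (fun j => testToSmooth n (cutTest f.1 f.2 j)) atTop (𝓝 f) := by
  rw [(smooth_withSeminorms n).tendsto_nhds]
  rintro ⟨q, K, N, C, hK, hC0, hC⟩ ε hε
  obtain ⟨R, hR⟩ := hK.isBounded.exists_norm_le
  filter_upwards [eventually_ge_atTop ⌈R⌉₊] with j hj
  refine lt_of_le_of_lt (hC _ 0 le_rfl fun m _ x hx => ?_) (by rwa [mul_zero])
  have h1 : ‖x‖ < j + 1 :=
    ((hR x hx).trans ((Nat.le_ceil R).trans (Nat.cast_le.2 hj))).trans_lt (lt_add_one _)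
  exact (norm_le_zero_iff.2 (iteratedFDeriv_cutTest_sub f.2 h1 m))

lemma eventually_testMul_cutTest (φ : Test n) :
    ∀ᶠ j in atTop, testMul φ (cutTest (fun _ => 1) contDiff_const j) = φ := by
  obtain ⟨R, hR⟩ := φ.hasCompactSupport.isBounded.exists_norm_le
  filter_upwards [eventually_ge_atTop ⌈R⌉₊] with j hj
  ext x
  change φ x * (cutOff n j x * 1) = φ x
  by_cases hx : φ x = 0
  · rw [hx, zero_mul]
  · have h1 : ‖x‖ ≤ j + 1 :=
      ((hR x (subset_tsupport _ hx)).trans ((Nat.le_ceil R).trans (Nat.cast_le.2 hj))).trans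
        (lt_add_one _).le
    rw [cutOff_eq_one h1, mul_one, mul_one]

end CutOff

section Injective

variable {n : ℕ}

lemma regularDist_injective {f g : Rn n → ℂ} (hf : Continuous f) (hg : Continuous g)
    (h : regularDist f = regularDist g) : f = g := by
  have h1 : ∀ᵐ x, f x = g x := by
    refine ae_eq_of_integral_contDiff_smul_eq hf.locallyIntegrable hg.locallyIntegrable
      fun u hu hc => ?_
    let ψ : Test n := ⟨fun x => (u x : ℂ), Complex.ofRealCLM.contDiff.comp hu,
      hc.comp_left (g := fun t : ℝ => (t : ℂ)) Complex.ofReal_zero, fun _ _ => trivial⟩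
    have h2 := DFunLike.congr_fun h ψ
    rw [regularDist_apply hf, regularDist_apply hg] at h2
    exact h2
  exact (Continuous.ae_eq_iff_eq _ hf hg).1 h1

lemma testToDist_injective : Function.Injective (testToDist n) := fun φ ψ h =>
  DFunLike.coe_injective (regularDist_injective φ.continuous ψ.continuous h)

/-- The inclusion `𝒮 → 𝒟'`. -/
def schwartzToDist (n : ℕ) : 𝓢(Rn n, ℂ) →ₗ[ℂ] Dist n ℂ where
  toFun f := regularDist f
  map_add' f g := regularDist_add f.continuous g.continuous
  map_smul' c f := regularDist_smul c f.continuous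

lemma schwartzToDist_injective : Function.Injective (schwartzToDist n) := fun f g h =>
  DFunLike.coe_injective (regularDist_injective f.continuous g.continuous h)

end Injective

/-! ### The pairs `(𝒟, 𝓔)` and `(𝒮, 𝓞_C)` -/

/-- The constant function `1`, as an element of `𝓔`. -/
def smoothOne (n : ℕ) : Smooth n :=
  ⟨fun _ => 1, (contDiff_const : ContDiff ℝ ∞ fun _ : Rn n => (1 : ℂ))⟩

lemma isMultiplierPair_test (n : ℕ) : IsMultiplierPair (ContinuousLinearMap.id ℂ (Test n))
    (testToSmooth n) (testToDist n) (mulTestSmooth n) (smoothOne n) where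
  dense_left := denseRange_id
  dense_right f := mem_closure_of_tendsto (tendsto_cutTest_smooth f)
    (Eventually.of_forall fun _ => mem_range_self _)
  injective := testToDist_injective
  incl_test _ := rfl
  mul_test _ _ := rfl
  mul_one φ := by ext x; exact mul_one (φ x)
  bounded_mul _ _ := isVonNBounded_mulTestSmooth
  continuous_mul := continuous_mulTestSmooth
  one_mem_closure φ := mem_closure_of_tendsto (tendsto_cutTest_smooth (smoothOne n))
    ((eventually_testMul_cutTest φ).mono fun _ hj => mem_image_of_mem _ hj)
  montel _ := test_montel

/-- The constant function `1`, as an element of `𝓞_C`. -/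
def ocOne (n : ℕ) : OC n :=
  ⟨fun _ => 1, contDiff_const, 0, fun N => ⟨1, zero_le_one, fun m _ x => by
    rw [pow_zero, mul_one]
    rcases m.eq_zero_or_pos with rfl | hm
    · simp
    · rw [iteratedFDeriv_const_of_ne hm.ne']
      simp⟩⟩

lemma mulSchwartzOC_one {n : ℕ} (f : 𝓢(Rn n, ℂ)) : mulSchwartzOC n f (ocOne n) = f := by
  ext x
  exact mul_one (f x)

/-- The functions `χ_j f`, with the cut-off functions `χ_j`, tend to `f` in `𝒮`, because `χ_j`
tends to `1` in `𝓞_C`. -/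
lemma denseRange_testToSchwartz (n : ℕ) : DenseRange (testToSchwartz n) := fun f => by
  have h := ((continuous_mulSchwartzOC f).tendsto (ocOne n)).comp (tendsto_cutTest_oc (ocOne n))
  rw [mulSchwartzOC_one] at h
  refine mem_closure_of_tendsto h (Eventually.of_forall fun j =>
    ⟨cutTest f (f.smooth ⊤) j, ?_⟩)
  ext x
  change cutOff n j x * f x = f x * (cutOff n j x * 1)
  ring

lemma isMultiplierPair_schwartz (n : ℕ) : IsMultiplierPair (testToSchwartz n) (testToOC n)
    (schwartzToDist n) (mulSchwartzOC n) (ocOne n) where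
  dense_left := denseRange_testToSchwartz n
  dense_right f := mem_closure_of_tendsto (tendsto_cutTest_oc f)
    (Eventually.of_forall fun _ => mem_range_self _)
  injective := schwartzToDist_injective
  incl_test _ := rfl
  mul_test _ _ := rfl
  mul_one := mulSchwartzOC_one
  bounded_mul _ _ := isVonNBounded_mulSchwartzOC
  continuous_mul := continuous_mulSchwartzOC
  one_mem_closure φ := mem_closure_of_tendsto (tendsto_cutTest_oc (ocOne n))
    ((eventually_testMul_cutTest φ).mono fun _ hj => mem_image_of_mem _ hj)
  montel _ := schwartz_montel

lemma isBornologicalInto_test (n : ℕ) (W : Type*) [AddCommGroup W] [Module ℂ W]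
    [TopologicalSpace W] [IsTopologicalAddGroup W] [ContinuousSMul ℂ W] [LocallyConvexSpace ℝ W] :
    IsBornologicalInto (Test n) W :=
  fun f hf => continuous_of_bounded_test f hf

/-- `𝒮` is bornological, because it is metrizable. -/
lemma isBornologicalInto_schwartz (n : ℕ) (W : Type*) [AddCommGroup W] [Module ℂ W]
    [TopologicalSpace W] [IsTopologicalAddGroup W] [ContinuousSMul ℂ W] :
    IsBornologicalInto 𝓢(Rn n, ℂ) W :=
  fun f hf => LinearMap.continuous_of_locally_bounded f hf

end VVDist

end

open VVDist in
theorem mainTheorem8 :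
    (∀ (n m : ℕ) (K L M : LCSubspace n ℂ) (E : LCSubspace m ℂ),
      K.IsNormal → L.IsNormal → M.IsNormal → E.IsNormal →
      HasTopologyGamma K.Elem → ConvexCompactness (DualC K.Elem) → ConvexCompactness E.Elem →
      M.toTopSubspace = OM K L →
      (M.vec E.Elem).toTopSubspace = OM K (L.vec E.Elem)) ∧
    (∀ (n m : ℕ) (E : LCSubspace m ℂ), E.IsNormal →
      ((spaceD' n).vec E.Elem).toTopSubspace = OM (spaceD n) ((spaceE' n).vec E.Elem)) ∧
    (∀ (n m : ℕ) (E : LCSubspace m ℂ), E.IsNormal →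
      ((spaceS' n).vec E.Elem).toTopSubspace = OM (spaceS n) ((spaceOC' n).vec E.Elem)) := by
  refine ⟨fun n m K L M E hK hL _ hE hγ hK' hE' hM => ?_, fun n m E hE => ?_, fun n m E hE => ?_⟩
  · have := hE.t2Space
    exact vec_eq_OM_vec hK hL hγ hK' hE' hM
  · have := hE.t2Space
    exact (isMultiplierPair_test n).vec_strongDual_eq_OM (isBornologicalInto_test n _)
      (isBornologicalInto_test n _)
  · have := hE.t2Space
    exact (isMultiplierPair_schwartz n).vec_strongDual_eq_OM (isBornologicalInto_schwartz n _)
      (isBornologicalInto_schwartz n _)
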